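/- Let $d$ be the hyperbolic distance on $\mathbb{H}^2$. For a closed discrete set $S\subset\mathbb{H}^2$ and $x\in S$ let $V_x=\{p\in\mathbb{H}^2 : d(p,x)\le d(p,y)\text{ for all }y\in S\}$ be the Voronoi cell of $x$. An edge of the Voronoi tessellation determined by $S$ is a set $e=V_x\cap V_y$ with $x\ne y$ in $S$ that contains more than one point (it may be unbounded); a vertex is a point lying in $V_x\cap V_y\cap V_z$ for three distinct $x,y,z\in S$. For a vertex $v$ let $J_v$ be the common distance from $v$ to the points $x\in S$ with $v\in V_x$, i.e. $J_v=d(v,S)$. An edge $e=V_x\cap V_y$ is centered if it meets the geodesic arc $\gamma_{xy}$ joining $x$ to $y$ at an interior point of $e$, and non-centered otherwise. Let $V^{(1)}_n$ be the union of the non-centered edges. For a connected component $T$ of $V^{(1)}_n$ let $T^{(0)}$ be the set of vertices lying on $T$. (1) For every closed discrete $S\subset\mathbb{H}^2$, every connected component $T$ of $V^{(1)}_n$ is a tree, with vertex set $T^{(0)}$ and with the non-centered edges contained in $T$ as its edges (an unbounded edge has a single end vertex). It is properly embedded: its edges form a locally finite family in $\mathbb{H}^2$, and two distinct edges meet at most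 in a vertex. (2) Let $F$ be a closed hyperbolic surface, $\pi\colon\mathbb{H}^2\to F$ a locally isometric universal covering, $\mathcal{S}\subset F$ a finite set, and $S=\pi^{-1}(\mathcal{S})$. Then every connected component $T$ of $V^{(1)}_n$ is a finite tree (finitely many vertices and edges, and compact); there is a unique vertex $v_T\in T^{(0)}$ such that $J_{v_T}>J_v$ for all $v\in T^{(0)}-\{v_T\}$; and $\pi$ maps $T$ homeomorphically onto its image in $F$. -/

import Mathlib

open UpperHalfPlane

/-! The hyperbolic plane is Mathlib's upper half-plane `ℍ` with its hyperbolic metric. -/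

namespace HypVoronoi

/-- The Voronoi cell `V_x` of `x` with respect to `S`. -/
def cell (S : Set ℍ) (x : ℍ) : Set ℍ :=
  {p | ∀ y ∈ S, dist p x ≤ dist p y}

/-- The geodesic arc `γ_{xy}` of the hyperbolic plane joining `x` to `y`. -/
def geodesicArc (x y : ℍ) : Set ℍ :=
  {p | dist x p + dist p y = dist x y}

/-- The interior of an edge, i.e. of a convex subset of a geodesic: the points of `e` that lie
strictly between two other points of `e`. -/
def edgeInterior (e : Set ℍ) : Set ℍ :=
  {p | p ∈ e ∧ ∃ a ∈ e, ∃ b ∈ e, a ≠ p ∧ b ≠ p ∧ p ∈ geodesicArc a b}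

/-- The vertices of the Voronoi tessellation determined by `S`: the points lying in the cells of
three distinct elements of `S`. -/
def vertices (S : Set ℍ) : Set ℍ :=
  {v | ∃ x ∈ S, ∃ y ∈ S, ∃ z ∈ S, x ≠ y ∧ x ≠ z ∧ y ≠ z ∧
    v ∈ cell S x ∩ cell S y ∩ cell S z}

/-- `e = V_x ∩ V_y` is an edge of the Voronoi tessellation determined by `S`.  Empty and one-point
intersections are not edges; unbounded edges (rays and lines) are allowed. -/
def IsEdge (S : Set ℍ) (x y : ℍ) (e : Set ℍ) : Prop :=
  x ∈ S ∧ y ∈ S ∧ x ≠ y ∧ e = cell S x ∩ cell S y ∧ e.Nontrivial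

/-- The edge `e = V_x ∩ V_y` is centered if it meets its geometric dual `γ_{xy}` at a point of
the interior of `e`. -/
def IsCenteredEdge (S : Set ℍ) (x y : ℍ) (e : Set ℍ) : Prop :=
  IsEdge S x y e ∧ (edgeInterior e ∩ geodesicArc x y).Nonempty

/-- The set of non-centered edges. -/
def nonCenteredEdges (S : Set ℍ) : Set (Set ℍ) :=
  {e | ∃ x y, IsEdge S x y e ∧ ¬ IsCenteredEdge S x y e}

/-- The union of the non-centered edges. -/
def nonCenteredUnion (S : Set ℍ) : Set ℍ :=
  ⋃₀ nonCenteredEdges S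

/-- `T` is a connected component of the union of the non-centered edges. -/
def IsNonCenteredComponent (S T : Set ℍ) : Prop :=
  ∃ p ∈ nonCenteredUnion S, T = connectedComponentIn (nonCenteredUnion S) p

/-- The vertices of the Voronoi tessellation lying on `T`. -/
def verticesOf (S T : Set ℍ) : Set ℍ :=
  vertices S ∩ T

/-- The non-centered edges contained in `T`. -/
def edgesOf (S T : Set ℍ) : Set (Set ℍ) :=
  {e | e ∈ nonCenteredEdges S ∧ e ⊆ T}

/-- The radius `J_v` of `v`: its distance from `S`. -/
noncomputable def radius (S : Set ℍ) (v : ℍ) : ℝ :=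
  Metric.infDist v S

/-- `J_v` is characterised by: `v ∈ V_x` if and only if `d(v, x) = J_v`, for every `x ∈ S`, as soon
as `v` lies in some cell. -/
theorem mem_cell_iff_dist_eq_radius {S : Set ℍ} {x v : ℍ} (hx : x ∈ S) :
    v ∈ cell S x ↔ dist v x = radius S v := by
  constructor
  · intro h
    refine le_antisymm ?_ (Metric.infDist_le_dist_of_mem hx)
    exact (Metric.le_infDist ⟨x, hx⟩).2 fun {y} hy => h y hy
  · intro h y hy
    rw [h]
    exact Metric.infDist_le_dist_of_mem hy

/-- The incidence graph of a set `V` of vertices and a set `E` of edges: a vertex `v` is joined to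
an edge `e` when `v` lies on `e`.  If all edges have two end vertices, this is the barycentric
subdivision of the graph; an edge with only one end vertex (a ray) becomes a leaf. -/
def incidenceGraph (V : Set ℍ) (E : Set (Set ℍ)) : SimpleGraph (V ⊕ E) :=
  SimpleGraph.fromRel fun a b =>
    ∃ (v : V) (e : E), a = Sum.inl v ∧ b = Sum.inr e ∧ (v : ℍ) ∈ (e : Set ℍ)

/-- `T` is a tree with vertex set `V` and set of (geodesic) edges `E`, properly embedded in the
hyperbolic plane: `T` is the union of the edges, the edges form a locally finite family, distinct
edges meet only in vertices, vertices are not interior to edges, and the resulting abstract graph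
is connected without cycles. -/
structure IsEmbeddedTree (T V : Set ℍ) (E : Set (Set ℍ)) : Prop where
  subset : V ⊆ T
  union_eq : ⋃₀ E = T
  locallyFinite : LocallyFinite fun e : E => (e : Set ℍ)
  inter_subset : ∀ e ∈ E, ∀ f ∈ E, e ≠ f → e ∩ f ⊆ V
  disjoint_interior : ∀ e ∈ E, Disjoint V (edgeInterior e)
  isTree : (incidenceGraph V E).IsTree

/-- `π : ℍ → F` is a locally isometric universal covering of the metric space `F`.  A closed
hyperbolic surface is a compact space `F` that admits such a covering. -/
structure IsLocallyIsometricCovering {F : Type*} [MetricSpace F] (π : ℍ → F) : Prop where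
  isCoveringMap : IsCoveringMap π
  surjective : Function.Surjective π
  locallyIsometric : ∀ p : ℍ, ∃ r > 0, ∀ a ∈ Metric.ball p r, ∀ b ∈ Metric.ball p r,
    dist (π a) (π b) = dist a b

end HypVoronoi

/-! The radius `J` serves as a height function. Parametrize the bisector of `x` and `y` by arc
length `t` from the midpoint of `γ_{xy}`; then `cosh J = cosh (d(x,y)/2) * cosh t` on the edge. A
non-centered edge cannot have points on both sides of `t = 0`, so `J` is strictly monotone along it
and the edge has a direction of increasing `J`.

The heart of the matter is that at most one non-centered edge leaves a given point `v` upward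
(`nonCenteredEdges_eq_of_radius_lt`). If the edge of `x, y` rises from `v` to `p`, the hyperbolic
law of cosines makes the angles at `v` between `p` and `x, y` at least `π / 2` (`cosh_mul_cosh_le`).
All sites nearest to `v` lie on one circle about `v`, and among them `x, y` are closest to `p`. Two
such configurations on one circle must coincide (`mem_pair_of_obtuse`), a statement about vectors in
the plane (`eq_of_obtuse_plane`).

A cycle of non-centered edges would have a lowest point with two ways up, so there is none
(`isAcyclic_of_height`). Connectedness of the incidence graph comes from that of `T` and local
finiteness of the edges.

Over a compact surface, deck transformations bring every point into a fixed ball. Hence `J` is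
bounded and takes finitely many values on vertices. Each non-centered edge then has an upper vertex,
and climbing from vertex to vertex stops after boundedly many steps of bounded length at a root.
Since climbing is deterministic and `T` is connected, all vertices of `T` reach the same root, where
`J` is strictly maximal (`BallFinite.exists_root`). So `T` is bounded, hence finite. A deck
transformation carrying one point of `T` to another preserves `T` and `J`, so it fixes the root and
is the identity; thus `π` is injective on `T`. -/

namespace HypVoronoi

/-! ### Hyperboloid coordinates and their normalizations -/

/-- Coordinates identifying the hyperbolic plane with a sheet of the hyperboloid in Minkowski
space. -/
structure LorentzChart where
  M : ℍ → ℝ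
  N : ℍ → ℝ
  W : ℍ → ℝ
  cosh_dist : ∀ z z', Real.cosh (dist z z') = M z * M z' - N z * N z' - W z * W z'
  pos : ∀ z, 0 < M z
  surj : ∀ m n w : ℝ, 0 < m → m ^ 2 - n ^ 2 - w ^ 2 = 1 → ∃ z, M z = m ∧ N z = n ∧ W z = w

namespace LorentzChart

theorem norm_eq (c : LorentzChart) (z : ℍ) : c.M z ^ 2 - c.N z ^ 2 - c.W z ^ 2 = 1 := by
  have := c.cosh_dist z z
  rw [dist_self, Real.cosh_zero] at this
  linarith

theorem ext_point (c : LorentzChart) {z z' : ℍ} (hM : c.M z = c.M z') (hN : c.N z = c.N z')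
    (hW : c.W z = c.W z') : z = z' := by
  have h := c.cosh_dist z z'
  have h1 := c.norm_eq z'
  rw [hM, hN, hW] at h
  have h2 : Real.cosh (dist z z') = 1 := by rw [h]; linarith
  have h3 : dist z z' = 0 := by
    by_contra hne
    have := Real.one_lt_cosh.2 hne
    linarith
  exact dist_eq_zero.1 h3

/-- The chart given by the standard coordinates of the half-plane. -/
noncomputable def base : LorentzChart where
  M z := (1 + z.re ^ 2 + z.im ^ 2) / (2 * z.im)
  N z := (z.re ^ 2 + z.im ^ 2 - 1) / (2 * z.im)
  W z := z.re / z.im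
  cosh_dist z z' := by
    rw [UpperHalfPlane.cosh_dist']
    have := z.im_ne_zero
    have := z'.im_ne_zero
    field_simp
    ring
  pos z := by
    have := z.im_pos
    positivity
  surj m n w hm h := by
    have hmn : 0 < m - n := by nlinarith [sq_nonneg w, sq_nonneg (m + n), sq_nonneg (m - n)]
    -- In these coordinates `M - N = 1 / im` and `W = re / im`, which determines the point.
    refine ⟨UpperHalfPlane.mk ⟨w / (m - n), 1 / (m - n)⟩ (by simpa using hmn), ?_, ?_, ?_⟩
    · simp only [UpperHalfPlane.re, UpperHalfPlane.im]
      field_simp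
      linarith
    · simp only [UpperHalfPlane.re, UpperHalfPlane.im]
      field_simp
      linarith
    · simp only [UpperHalfPlane.re, UpperHalfPlane.im]
      field_simp

/-- Composition of a chart with a rotation. -/
noncomputable def rotate (ch : LorentzChart) (c s : ℝ) (h : c ^ 2 + s ^ 2 = 1) : LorentzChart where
  M := ch.M
  N z := c * ch.N z - s * ch.W z
  W z := s * ch.N z + c * ch.W z
  cosh_dist z z' := by
    rw [ch.cosh_dist]
    linear_combination (ch.N z * ch.N z' + ch.W z * ch.W z') * h
  pos := ch.pos
  surj m n w hm hn := by
    obtain ⟨z, h1, h2, h3⟩ := ch.surj m (c * n + s * w) (-s * n + c * w) hm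
      (by linear_combination hn - (n ^ 2 + w ^ 2) * h)
    refine ⟨z, h1, ?_, ?_⟩
    · rw [h2, h3]; linear_combination n * h
    · rw [h2, h3]; linear_combination w * h

theorem boost_pos {a b m n w : ℝ} (ha : 0 < a) (h : a ^ 2 - b ^ 2 = 1) (hm : 0 < m)
    (hn : m ^ 2 - n ^ 2 - w ^ 2 = 1) : 0 < a * m - b * w := by
  have h1 : (b * w) ^ 2 < (a * m) ^ 2 := by
    have : (a * m) ^ 2 - (b * w) ^ 2 = 1 + n ^ 2 + w ^ 2 + b ^ 2 + b ^ 2 * n ^ 2 := by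
      have e1 : a ^ 2 = 1 + b ^ 2 := by linarith
      have e2 : m ^ 2 = 1 + n ^ 2 + w ^ 2 := by linarith
      rw [mul_pow, e1, e2]; ring
    nlinarith [sq_nonneg n, sq_nonneg w, sq_nonneg b, sq_nonneg (b * n)]
  linarith [abs_lt_of_sq_lt_sq h1 (by positivity), le_abs_self (b * w)]

/-- Composition of a chart with a Lorentz boost. -/
noncomputable def boost (ch : LorentzChart) (a b : ℝ) (ha : 0 < a) (h : a ^ 2 - b ^ 2 = 1) :
    LorentzChart where
  M z := a * ch.M z - b * ch.W z
  N := ch.N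
  W z := a * ch.W z - b * ch.M z
  cosh_dist z z' := by
    rw [ch.cosh_dist]
    linear_combination (ch.W z * ch.W z' - ch.M z * ch.M z') * h
  pos z := boost_pos ha h (ch.pos z) (ch.norm_eq z)
  surj m n w hm hn := by
    obtain ⟨z, h1, h2, h3⟩ := ch.surj (a * m + b * w) n (a * w + b * m)
      (by simpa using boost_pos (b := -b) ha (by simpa using h) hm hn)
      (by linear_combination hn + (m ^ 2 - w ^ 2) * h)
    refine ⟨z, ?_, h2, ?_⟩
    · rw [h1, h3]; linear_combination m * h
    · rw [h1, h3]; linear_combination w * h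

/-- Any chart can be rotated so that a given point gets `N = 0` and `W ≥ 0`. -/
theorem exists_rotate (ch : LorentzChart) (z : ℍ) :
    ∃ ch' : LorentzChart, ch'.M = ch.M ∧ ch'.N z = 0 ∧ 0 ≤ ch'.W z := by
  by_cases h : ch.N z ^ 2 + ch.W z ^ 2 = 0
  · exact ⟨ch, rfl, by nlinarith [sq_nonneg (ch.N z), sq_nonneg (ch.W z)],
      by nlinarith [sq_nonneg (ch.N z), sq_nonneg (ch.W z)]⟩
  · have h0 : 0 < ch.N z ^ 2 + ch.W z ^ 2 := lt_of_le_of_ne (by positivity) (Ne.symm h)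
    set r := √(ch.N z ^ 2 + ch.W z ^ 2) with hr
    have hr0 : 0 < r := Real.sqrt_pos.2 h0
    have hr2 : r ^ 2 = ch.N z ^ 2 + ch.W z ^ 2 := Real.sq_sqrt h0.le
    refine ⟨ch.rotate (ch.W z / r) (ch.N z / r) ?_, rfl, ?_, ?_⟩
    · field_simp; linarith
    · simp only [rotate]; ring
    · simp only [rotate]
      have : ch.N z / r * ch.N z + ch.W z / r * ch.W z = r := by
        field_simp; linarith
      rw [this]; exact hr0.le

theorem exists_centered (v : ℍ) : ∃ ch : LorentzChart, ch.M v = 1 ∧ ch.N v = 0 ∧ ch.W v = 0 := by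
  obtain ⟨ch, -, hN, -⟩ := base.exists_rotate v
  have h := ch.norm_eq v
  -- With `N v = 0`, this boost is the one carrying `v` to the origin `(1, 0, 0)`.
  refine ⟨ch.boost (ch.M v) (ch.W v) (ch.pos v) (by rw [hN] at h; linarith), ?_, hN, ?_⟩
  · simp only [boost]; rw [hN] at h; linarith
  · simp only [boost]; ring

/-- A chart centered at `v` in which `p` lies on the positive `W`-axis. -/
theorem exists_flag {v p : ℍ} (hvp : v ≠ p) : ∃ ch : LorentzChart,
    ch.M v = 1 ∧ ch.N v = 0 ∧ ch.W v = 0 ∧ ch.N p = 0 ∧ 0 < ch.W p := by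
  obtain ⟨ch, hM, hN, hW⟩ := exists_centered v
  obtain ⟨ch', hM', hN', hW'⟩ := ch.exists_rotate p
  have h1 : ch'.M v = 1 := by rw [hM', hM]
  have h2 := ch'.norm_eq v
  rw [h1] at h2
  have h3 : ch'.N v = 0 := by nlinarith [sq_nonneg (ch'.N v), sq_nonneg (ch'.W v)]
  have h4 : ch'.W v = 0 := by nlinarith [sq_nonneg (ch'.N v), sq_nonneg (ch'.W v)]
  refine ⟨ch', h1, h3, h4, hN', lt_of_le_of_ne hW' fun h => hvp ?_⟩
  have h5 := ch'.norm_eq p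
  rw [hN', ← h] at h5
  refine ch'.ext_point ?_ (by rw [h3, hN']) (by rw [h4, h])
  rw [h1]; nlinarith [ch'.pos p]

/-- A chart in which `x` and `y` are symmetric about the line `W = 0`. -/
theorem exists_symmetric {x y : ℍ} (hxy : x ≠ y) : ∃ ch : LorentzChart,
    ch.M x = Real.cosh (dist x y / 2) ∧ ch.M y = Real.cosh (dist x y / 2) ∧
    ch.N x = 0 ∧ ch.N y = 0 ∧
    ch.W x = -Real.sinh (dist x y / 2) ∧ ch.W y = Real.sinh (dist x y / 2) := by
  obtain ⟨ch, hM, hN, hW, hNy, hWy⟩ := exists_flag hxy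
  have h1 := ch.cosh_dist x y
  rw [hM, hN, hW] at h1
  have hMy : ch.M y = Real.cosh (dist x y) := by linarith
  have h2 := ch.norm_eq y
  rw [hNy, hMy] at h2
  have hWy' : ch.W y = Real.sinh (dist x y) := by
    have h3 : ch.W y ^ 2 = Real.sinh (dist x y) ^ 2 := by
      linarith [Real.cosh_sq (dist x y)]
    exact (pow_left_inj₀ hWy.le (Real.sinh_nonneg_iff.2 dist_nonneg) two_ne_zero).1 h3
  set t := dist x y / 2 with ht
  have hd : dist x y = t + t := by rw [ht]; ring
  rw [hd] at hMy hWy'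
  rw [Real.cosh_add] at hMy
  rw [Real.sinh_add] at hWy'
  have hc := Real.cosh_sq t
  -- So far `x` is the origin and `y` lies at distance `2 * t` on the `W`-axis; boosting by `t`
  -- moves their midpoint to the origin.
  refine ⟨ch.boost (Real.cosh t) (Real.sinh t) (Real.cosh_pos t) (by linarith), ?_, ?_, hN, hNy,
    ?_, ?_⟩
  · simp [boost, hM, hW]
  · simp only [boost, hMy, hWy']; linear_combination (Real.cosh t) * hc
  · simp [boost, hM, hW]
  · simp only [boost, hMy, hWy']; linear_combination (Real.sinh t) * hc

end LorentzChart

/-! ### Circles and obtuse angles -/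

theorem cosh_dist_le_cosh_dist {a b c d : ℍ} :
    Real.cosh (dist a b) ≤ Real.cosh (dist c d) ↔ dist a b ≤ dist c d := by
  rw [Real.cosh_le_cosh, abs_of_nonneg dist_nonneg, abs_of_nonneg dist_nonneg]

theorem cosh_dist_lt_cosh_dist {a b c d : ℍ} :
    Real.cosh (dist a b) < Real.cosh (dist c d) ↔ dist a b < dist c d := by
  rw [Real.cosh_lt_cosh, abs_of_nonneg dist_nonneg, abs_of_nonneg dist_nonneg]

/-- Two distinct circles meet in at most two points. -/
theorem eq_or_eq_of_equidistant {a b x y z : ℍ} (hab : a ≠ b) (hxy : x ≠ y)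
    (hay : dist a x = dist a y) (haz : dist a x = dist a z)
    (hby : dist b x = dist b y) (hbz : dist b x = dist b z) : z = x ∨ z = y := by
  obtain ⟨ch, hM, hN, hW, hNb, hWb⟩ := LorentzChart.exists_flag hab
  -- The distance to the origin `a` fixes `M`, the distance to `b` then fixes `W`, and the norm
  -- equation leaves only the sign of `N`.
  have key : ∀ w, dist a x = dist a w → dist b x = dist b w → ch.M w = ch.M x ∧ ch.W w = ch.W x ∧
      (ch.N w - ch.N x) * (ch.N w + ch.N x) = 0 := by
    intro w ha hb
    have h1 := congrArg Real.cosh ha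
    have h2 := congrArg Real.cosh hb
    rw [ch.cosh_dist, ch.cosh_dist, hM, hN, hW] at h1
    have h3 : ch.M w = ch.M x := by linarith
    rw [ch.cosh_dist, ch.cosh_dist, hNb, h3] at h2
    have h4 : ch.W w = ch.W x := mul_left_cancel₀ hWb.ne' (by linarith)
    refine ⟨h3, h4, ?_⟩
    have h5 := ch.norm_eq w
    have h6 := ch.norm_eq x
    rw [h3, h4] at h5
    linarith
  obtain ⟨y1, y2, y3⟩ := key y hay hby
  obtain ⟨z1, z2, z3⟩ := key z haz hbz
  rcases mul_eq_zero.1 z3 with h | h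
  · exact .inl (ch.ext_point z1 (by linarith) z2)
  · rcases mul_eq_zero.1 y3 with h' | h'
    · exact absurd (ch.ext_point y1.symm (by linarith) y2.symm) hxy
    · exact .inr (ch.ext_point (by linarith) (by linarith) (by linarith))

/-- Planar form of `mem_pair_of_obtuse`: `(±s, κ)`, `(n, w)`, `(n', w')` are vectors of the same
length. -/
theorem eq_of_obtuse_plane {a b s κ n w n' w' : ℝ} (hab : 0 < a ^ 2 + b ^ 2) (hs : s ≠ 0)
    (hne : n ≠ n' ∨ w ≠ w') (hnorm : n ^ 2 + w ^ 2 = n' ^ 2 + w' ^ 2)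
    (Wx0 : κ ≤ 0) (Wx' : w ≤ κ) (Wy' : w' ≤ κ)
    (hk : a * n + b * w ≤ 0) (h1 : a * s + b * κ ≤ a * n + b * w)
    (h2 : -(a * s) + b * κ ≤ a * n + b * w) (hk' : a * n + b * w = a * n' + b * w') :
    w = κ ∧ w' = κ := by
  -- The difference of `(n, w)` and `(n', w')` is orthogonal to `(a, b)`, and to their sum because
  -- the lengths agree; so the sum is parallel to `(a, b)`.
  have hperp : a * (w + w') = b * (n + n') := by
    have e2 : a * (n - n') + b * (w - w') = 0 := by linarith
    have e3 : (n - n') * (n + n') + (w - w') * (w + w') = 0 := by linarith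
    rcases hne with h | h
    · refine mul_left_cancel₀ (sub_ne_zero.2 h) ?_
      linear_combination (w + w') * e2 - b * e3
    · refine mul_left_cancel₀ (sub_ne_zero.2 h) ?_
      linear_combination -(n + n') * e2 + a * e3
  have hsum : (a ^ 2 + b ^ 2) * (w + w') = b * (2 * (a * n + b * w)) := by
    linear_combination a * hperp - b * hk'
  have hsum' : b * (a * n + b * w) ≤ (a ^ 2 + b ^ 2) * κ := by nlinarith
  -- The goal is that both directions lie on the same axis. Averaging `h1` and `h2` gives `b * κ ≤ a
  -- * n + b * w`; for `κ < 0` this and `hsum'` force `a = 0`. For `κ = 0` they bound `±(a * s)` by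
  -- `0`.
  have ha : a = 0 := by
    rcases Wx0.lt_or_eq with hκ | hκ
    · have hbk : b * (a * n + b * w) < 0 :=
        lt_of_le_of_lt hsum' (mul_neg_of_pos_of_neg hab hκ)
      have hb : 0 < b := by
        by_contra! hb
        nlinarith
      have h3 : b * (b * κ) ≤ b * (a * n + b * w) := by
        apply mul_le_mul_of_nonneg_left _ hb.le; linarith
      have h4 : a ^ 2 * (-κ) ≤ 0 := by nlinarith
      have h5 : a ^ 2 ≤ 0 := by
        by_contra! h
        have := mul_pos h (neg_pos.2 hκ)
        linarith
      nlinarith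
    · subst hκ
      have h3 : a * s = 0 := by linarith
      exact (mul_eq_zero.1 h3).resolve_right hs
  subst ha
  have hb0 : b ≠ 0 := by rintro rfl; simp at hab
  have hw : w = w' := mul_left_cancel₀ hb0 (by linarith)
  subst hw
  have : κ ≤ w := by
    rcases lt_or_gt_of_ne hb0 with hb | hb
    · have h5 : 0 ≤ w := by
        by_contra! h
        linarith [mul_pos_of_neg_of_neg hb h]
      linarith
    · exact le_of_mul_le_mul_left (by linarith) hb
  exact ⟨le_antisymm Wx' this, le_antisymm Wx' this⟩

/-- If `x, y` (resp. `x', y'`) are the closest to `p` (resp. `p'`) among points on a circle about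
`v`, and the directions of `p` and `p'` from `v` make angles at least `π / 2` with those of
`x, y` and `x', y'`, then the two pairs agree. -/
theorem mem_pair_of_obtuse {v p p' x y x' y' : ℍ} (hp : v ≠ p) (hp' : v ≠ p') (hxy : x ≠ y)
    (hxy' : x' ≠ y')
    (vy : dist v x = dist v y) (vx' : dist v x = dist v x') (vy' : dist v x = dist v y')
    (py : dist p x = dist p y) (px' : dist p x ≤ dist p x') (py' : dist p x ≤ dist p y')
    (py'' : dist p' x' = dist p' y') (px : dist p' x' ≤ dist p' x) (py3 : dist p' x' ≤ dist p' y)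
    (ob : Real.cosh (dist v p) * Real.cosh (dist v x) ≤ Real.cosh (dist p x))
    (ob' : Real.cosh (dist v p') * Real.cosh (dist v x') ≤ Real.cosh (dist p' x')) :
    (x' = x ∨ x' = y) ∧ (y' = x ∨ y' = y) := by
  obtain ⟨ch, hM, hN, hW, hNp, hWp⟩ := LorentzChart.exists_flag hp
  have hv : ∀ w, Real.cosh (dist v w) = ch.M w := fun w => by
    rw [ch.cosh_dist, hM, hN, hW]; ring
  have My : ch.M y = ch.M x := by rw [← hv, ← hv, vy]
  have Mx' : ch.M x' = ch.M x := by rw [← hv, ← hv, vx']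
  have My' : ch.M y' = ch.M x := by rw [← hv, ← hv, vy']
  have hpw : ∀ w, Real.cosh (dist p w) = ch.M p * ch.M w - ch.W p * ch.W w := fun w => by
    rw [ch.cosh_dist, hNp]; ring
  rw [hv, hv, hpw] at ob
  rw [hv, hv, ch.cosh_dist, Mx'] at ob'
  have Wy : ch.W y = ch.W x := by
    have := congrArg Real.cosh py
    rw [hpw, hpw, My] at this
    exact mul_left_cancel₀ hWp.ne' (by linarith)
  have Wx0 : ch.W x ≤ 0 := by
    by_contra! h
    have := mul_pos hWp h
    linarith
  have Wx' : ch.W x' ≤ ch.W x := by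
    rw [← cosh_dist_le_cosh_dist, hpw, hpw, Mx'] at px'
    exact le_of_mul_le_mul_left (by linarith) hWp
  have Wy' : ch.W y' ≤ ch.W x := by
    rw [← cosh_dist_le_cosh_dist, hpw, hpw, My'] at py'
    exact le_of_mul_le_mul_left (by linarith) hWp
  have e1 := congrArg Real.cosh py''
  rw [ch.cosh_dist, ch.cosh_dist, Mx', My'] at e1
  rw [← cosh_dist_le_cosh_dist, ch.cosh_dist, ch.cosh_dist, Mx'] at px
  rw [← cosh_dist_le_cosh_dist, ch.cosh_dist, ch.cosh_dist, Mx', My] at py3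
  have nx := ch.norm_eq x
  have ny := ch.norm_eq y
  have nx' := ch.norm_eq x'
  have ny' := ch.norm_eq y'
  have np' := ch.norm_eq p'
  rw [My] at ny
  rw [Mx'] at nx'
  rw [My'] at ny'
  -- `y` is the mirror image of `x` in the line through `v` and `p`.
  have Ny : ch.N y = -ch.N x := by
    have : (ch.N y - ch.N x) * (ch.N y + ch.N x) = 0 := by rw [Wy] at ny; linarith
    rcases mul_eq_zero.1 this with h | h
    · exact absurd (ch.ext_point My.symm (by linarith) Wy.symm) hxy
    · linarith
  have Nx0 : ch.N x ≠ 0 := fun h => hxy (ch.ext_point My.symm (by rw [Ny, h]; ring) Wy.symm)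
  have hab : 0 < ch.N p' ^ 2 + ch.W p' ^ 2 := by
    refine lt_of_le_of_ne (by positivity) fun h => hp' ?_
    have h1 : ch.N p' = 0 := sq_eq_zero_iff.1 <| by
      linarith [sq_nonneg (ch.N p'), sq_nonneg (ch.W p')]
    have h2 : ch.W p' = 0 := sq_eq_zero_iff.1 <| by
      linarith [sq_nonneg (ch.N p'), sq_nonneg (ch.W p')]
    refine ch.ext_point ?_ (by rw [hN, h1]) (by rw [hW, h2])
    rw [h1, h2] at np'
    rw [hM, (pow_eq_one_iff_of_nonneg (ch.pos p').le two_ne_zero).1 (by linarith)]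
  have hne : ch.N x' ≠ ch.N y' ∨ ch.W x' ≠ ch.W y' := by
    by_contra! h
    exact hxy' (ch.ext_point (by rw [Mx', My']) h.1 h.2)
  rw [Wy, Ny] at py3
  suffices h : ch.W x' = ch.W x ∧ ch.W y' = ch.W x by
    have fin : ∀ w, ch.M w = ch.M x → ch.W w = ch.W x → w = x ∨ w = y := fun w h1 h2 => by
      refine eq_or_eq_of_equidistant hp hxy vy ?_ py ?_
      · rw [← Real.cosh_strictMonoOn.injOn.eq_iff (Set.mem_Ici.2 dist_nonneg)
          (Set.mem_Ici.2 dist_nonneg), hv, hv, h1]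
      · rw [← Real.cosh_strictMonoOn.injOn.eq_iff (Set.mem_Ici.2 dist_nonneg)
          (Set.mem_Ici.2 dist_nonneg), hpw, hpw, h1, h2]
    exact ⟨fin x' Mx' h.1, fin y' My' h.2⟩
  refine eq_of_obtuse_plane hab Nx0 hne ?_ Wx0 Wx' Wy' ?_ ?_ ?_ ?_ <;> linarith


/-! ### Perpendicular bisectors by arc length -/

theorem dist_eq_iff_cosh_eq {a b : ℝ} (ha : 0 ≤ a) (hb : 0 ≤ b) :
    Real.cosh a = Real.cosh b ↔ a = b :=
  Real.cosh_strictMonoOn.injOn.eq_iff ha hb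

/-- `φ` parametrizes the perpendicular bisector of `x` and `y` by arc length, starting at the
midpoint. -/
structure IsBisectorParam (x y : ℍ) (φ : ℝ → ℍ) : Prop where
  isometry : Isometry φ
  dist_eq : ∀ t, dist (φ t) x = dist (φ t) y
  exists_eq : ∀ p, dist p x = dist p y → ∃ t, φ t = p
  cosh_dist : ∀ t, Real.cosh (dist (φ t) x) = Real.cosh (dist x y / 2) * Real.cosh t
  linear : ∀ z, ∃ A B, ∀ t, Real.cosh (dist (φ t) z) = A * Real.cosh t + B * Real.sinh t

theorem exists_isBisectorParam {x y : ℍ} (hxy : x ≠ y) : ∃ φ, IsBisectorParam x y φ := by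
  obtain ⟨ch, Mx, My, Nx, Ny, Wx, Wy⟩ := LorentzChart.exists_symmetric hxy
  have hs : 0 < Real.sinh (dist x y / 2) := Real.sinh_pos_iff.2 (half_pos (dist_pos.2 hxy))
  choose φ hM hN hW using fun t : ℝ => ch.surj (Real.cosh t) (Real.sinh t) 0 (Real.cosh_pos t)
    (by linarith [Real.cosh_sq t])
  have hz : ∀ t z, Real.cosh (dist (φ t) z) = ch.M z * Real.cosh t + -ch.N z * Real.sinh t :=
    fun t z => by rw [ch.cosh_dist, hM, hN, hW]; ring
  refine ⟨φ, Isometry.of_dist_eq fun s t => ?_, fun t => ?_, fun p hp => ?_, fun t => ?_,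
    fun z => ⟨_, _, fun t => hz t z⟩⟩
  · rw [← dist_eq_iff_cosh_eq dist_nonneg dist_nonneg, hz, hM, hN, Real.dist_eq, Real.cosh_abs,
      Real.cosh_sub]
    ring
  · rw [← dist_eq_iff_cosh_eq dist_nonneg dist_nonneg, hz, hz, Mx, My, Nx, Ny]
  · rw [← dist_eq_iff_cosh_eq dist_nonneg dist_nonneg, ch.cosh_dist, ch.cosh_dist, Mx, My, Nx, Ny,
      Wx, Wy] at hp
    have hWp : ch.W p = 0 := by
      have : ch.W p * Real.sinh (dist x y / 2) = 0 := by linarith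
      exact (mul_eq_zero.1 this).resolve_right hs.ne'
    refine ⟨Real.arsinh (ch.N p), ch.ext_point ?_ (by rw [hN, Real.sinh_arsinh])
      (by rw [hW, hWp])⟩
    have h1 := ch.norm_eq p
    have h2 := ch.norm_eq (φ (Real.arsinh (ch.N p)))
    rw [hN, hW, Real.sinh_arsinh] at h2
    rw [hWp] at h1
    exact (pow_left_inj₀ (ch.pos _).le (ch.pos p).le two_ne_zero).1 (by linarith)
  · rw [hz, Mx, Nx]; ring

/-- For `r < s < t` this writes the value at `s` of a combination of `cosh` and `sinh` as a positive
combination of its values at `r` and `t`. Differences of `cosh` distances along a bisector have this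
form, so it replaces convexity arguments for edges. -/
theorem sinh_interpolation (A B r s t : ℝ) :
    Real.sinh (t - r) * (A * Real.cosh s + B * Real.sinh s) =
      Real.sinh (t - s) * (A * Real.cosh r + B * Real.sinh r) +
        Real.sinh (s - r) * (A * Real.cosh t + B * Real.sinh t) := by
  rw [Real.sinh_sub, Real.sinh_sub, Real.sinh_sub]
  ring

namespace IsBisectorParam

variable {x y : ℍ} {φ : ℝ → ℍ}

theorem neg (h : IsBisectorParam x y φ) : IsBisectorParam x y fun t => φ (-t) where
  isometry := h.isometry.comp (IsometryEquiv.neg ℝ).isometry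
  dist_eq t := h.dist_eq (-t)
  exists_eq p hp := by
    obtain ⟨t, rfl⟩ := h.exists_eq p hp
    exact ⟨-t, by rw [neg_neg]⟩
  cosh_dist t := by rw [h.cosh_dist, Real.cosh_neg]
  linear z := by
    obtain ⟨A, B, hAB⟩ := h.linear z
    exact ⟨A, -B, fun t => by rw [hAB, Real.cosh_neg, Real.sinh_neg]; ring⟩

theorem mem_iff (h : IsBisectorParam x y φ) {S : Set ℍ} {t : ℝ} :
    φ t ∈ cell S x ∩ cell S y ↔ ∀ z ∈ S, dist (φ t) x ≤ dist (φ t) z :=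
  ⟨fun hm => hm.1, fun hm => ⟨hm, fun z hz => by rw [← h.dist_eq]; exact hm z hz⟩⟩

/-- The bisector crosses the arc only at its midpoint, so being centered means having parameter `0`
in the interior. -/
theorem mem_geodesicArc_iff (h : IsBisectorParam x y φ) {t : ℝ} :
    φ t ∈ geodesicArc x y ↔ t = 0 := by
  have h1 : φ t ∈ geodesicArc x y ↔ dist (φ t) x = dist x y / 2 := by
    have := h.dist_eq t
    simp only [geodesicArc, Set.mem_ofPred_eq]
    rw [dist_comm x (φ t), ← this]
    constructor <;> intro h' <;> linarith
  rw [h1, ← dist_eq_iff_cosh_eq dist_nonneg (by positivity), h.cosh_dist,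
    mul_eq_left₀ (Real.cosh_pos _).ne']
  constructor
  · intro h2
    by_contra h3
    exact absurd h2 (Real.one_lt_cosh.2 h3).ne'
  · rintro rfl
    exact Real.cosh_zero

theorem between_iff (h : IsBisectorParam x y φ) {r s t : ℝ} :
    φ s ∈ geodesicArc (φ r) (φ t) ↔ (r ≤ s ∧ s ≤ t) ∨ (t ≤ s ∧ s ≤ r) := by
  simp only [geodesicArc, Set.mem_ofPred_eq, h.isometry.dist_eq, Real.dist_eq]
  constructor
  · intro hh
    rcases abs_cases (r - s) with h1 | h1 <;> rcases abs_cases (s - t) with h2 | h2 <;>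
      rcases abs_cases (r - t) with h3 | h3 <;>
      first
        | exact .inl ⟨by linarith, by linarith⟩
        | exact .inr ⟨by linarith, by linarith⟩
  · rintro (⟨h1, h2⟩ | ⟨h1, h2⟩)
    · rw [abs_of_nonpos (by linarith), abs_of_nonpos (by linarith), abs_of_nonpos (by linarith)]
      ring
    · rw [abs_of_nonneg (by linarith), abs_of_nonneg (by linarith), abs_of_nonneg (by linarith)]
      ring

theorem exists_linear_sub (h : IsBisectorParam x y φ) (z : ℍ) : ∃ A B, ∀ t,
    Real.cosh (dist (φ t) z) - Real.cosh (dist (φ t) x) = A * Real.cosh t + B * Real.sinh t := by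
  obtain ⟨A, B, hAB⟩ := h.linear z
  exact ⟨A - Real.cosh (dist x y / 2), B, fun t => by rw [hAB, h.cosh_dist]; ring⟩

theorem mem_of_between (h : IsBisectorParam x y φ) {S : Set ℍ} {r s t : ℝ}
    (hr : φ r ∈ cell S x ∩ cell S y) (ht : φ t ∈ cell S x ∩ cell S y) (hrs : r ≤ s) (hst : s ≤ t) :
    φ s ∈ cell S x ∩ cell S y := by
  rcases eq_or_lt_of_le hrs with rfl | hrs
  · exact hr
  rw [h.mem_iff] at *
  intro z hz
  have h1 := hr z hz
  have h2 := ht z hz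
  rw [← cosh_dist_le_cosh_dist, ← sub_nonneg] at *
  obtain ⟨A, B, hAB⟩ := h.exists_linear_sub z
  rw [hAB] at *
  have h3 := sinh_interpolation A B r s t
  have h4 : 0 < Real.sinh (t - r) := Real.sinh_pos_iff.2 (by linarith)
  have h5 : 0 ≤ Real.sinh (t - s) := Real.sinh_nonneg_iff.2 (by linarith)
  have h6 : 0 ≤ Real.sinh (s - r) := Real.sinh_nonneg_iff.2 (by linarith)
  refine nonneg_of_mul_nonneg_right ?_ h4
  rw [h3]
  positivity

/-- The difference `cosh d(·, z) - cosh d(·, x)` is nonnegative at `r` and `t` and vanishes at `s`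
between them, so by interpolation it vanishes at `r` and `t` too. Then `x, y, z` lie on two distinct
circles, which share at most two points. -/
theorem eq_or_eq_of_mem_interior (h : IsBisectorParam x y φ) (hxy : x ≠ y) {S : Set ℍ} {r s t : ℝ}
    (hr : φ r ∈ cell S x ∩ cell S y) (ht : φ t ∈ cell S x ∩ cell S y) (hrs : r < s) (hst : s < t)
    {z : ℍ} (hz : z ∈ S) (hsz : dist (φ s) x = dist (φ s) z) : z = x ∨ z = y := by
  rw [h.mem_iff] at *
  have h1 := hr z hz
  have h2 := ht z hz
  rw [← cosh_dist_le_cosh_dist, ← sub_nonneg] at h1 h2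
  obtain ⟨A, B, hAB⟩ := h.exists_linear_sub z
  have h0 := hAB s
  rw [hsz, sub_self] at h0
  have h3 := sinh_interpolation A B r s t
  rw [← h0, mul_zero, ← hAB, ← hAB] at h3
  have h5 : 0 < Real.sinh (t - s) := Real.sinh_pos_iff.2 (by linarith)
  have h6 : 0 < Real.sinh (s - r) := Real.sinh_pos_iff.2 (by linarith)
  have h7 := mul_nonneg h5.le h1
  have h8 := mul_nonneg h6.le h2
  have h9 := (mul_eq_zero.1 (le_antisymm (by linarith) h7)).resolve_left h5.ne'
  have h10 := (mul_eq_zero.1 (le_antisymm (by linarith) h8)).resolve_left h6.ne'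
  refine eq_or_eq_of_equidistant (a := φ r) (b := φ t)
    (h.isometry.injective.ne (hrs.trans hst).ne) hxy (h.dist_eq r) ?_ (h.dist_eq t) ?_
  · rw [← dist_eq_iff_cosh_eq dist_nonneg dist_nonneg]; linarith
  · rw [← dist_eq_iff_cosh_eq dist_nonneg dist_nonneg]; linarith

theorem mem_edgeInterior_iff (h : IsBisectorParam x y φ) {S : Set ℍ} (hx : x ∈ S) (hy : y ∈ S)
    {s : ℝ} :
    φ s ∈ edgeInterior (cell S x ∩ cell S y) ↔
      ∃ r t, r < s ∧ s < t ∧ φ r ∈ cell S x ∩ cell S y ∧ φ t ∈ cell S x ∩ cell S y := by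
  constructor
  · rintro ⟨hs, a, ha, b, hb, has, hbs, hab⟩
    obtain ⟨r, rfl⟩ := h.exists_eq a (le_antisymm (ha.1 _ hy) (ha.2 _ hx))
    obtain ⟨t, rfl⟩ := h.exists_eq b (le_antisymm (hb.1 _ hy) (hb.2 _ hx))
    have h1 : r ≠ s := fun h' => has (h' ▸ rfl)
    have h2 : t ≠ s := fun h' => hbs (h' ▸ rfl)
    rcases h.between_iff.1 hab with h3 | h3
    · exact ⟨r, t, lt_of_le_of_ne h3.1 h1, lt_of_le_of_ne h3.2 h2.symm, ha, hb⟩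
    · exact ⟨t, r, lt_of_le_of_ne h3.1 h2, lt_of_le_of_ne h3.2 h1.symm, hb, ha⟩
  · rintro ⟨r, t, hrs, hst, hr, ht⟩
    exact ⟨h.mem_of_between hr ht hrs.le hst.le, _, hr, _, ht, h.isometry.injective.ne hrs.ne,
      h.isometry.injective.ne hst.ne', h.between_iff.2 (.inl ⟨hrs.le, hst.le⟩)⟩

end IsBisectorParam

/-! ### Local finiteness of sites, and cells -/

/-- `S` has finitely many points in every ball. -/
def BallFinite (S : Set ℍ) : Prop :=
  ∀ p r, (S ∩ Metric.closedBall p r).Finite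

theorem ballFinite_of_isClosed_of_isDiscrete {S : Set ℍ} (hc : IsClosed S) (hd : IsDiscrete S) :
    BallFinite S := fun p r =>
  ((isCompact_closedBall p r).inter_left hc).finite (hd.mono Set.inter_subset_left)

theorem BallFinite.exists_gap {S : Set ℍ} (hS : BallFinite S) (p : ℍ) (R : ℝ) :
    ∃ ε > 0, ∀ z ∈ S, R < dist p z → R + ε ≤ dist p z := by
  have hfin := (hS p (R + 1)).image (dist p)
  set D := (dist p '' (S ∩ Metric.closedBall p (R + 1))) ∩ Set.Ioi R with hD
  have hDf : D.Finite := hfin.inter_of_left _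
  obtain ⟨ε, hε, h⟩ : ∃ ε > 0, ∀ d ∈ D, R + ε ≤ d := by
    rcases D.eq_empty_or_nonempty with h0 | h0
    · exact ⟨1, one_pos, by simp [h0]⟩
    · obtain ⟨d, hd, hmin⟩ := Set.exists_min_image D id hDf h0
      exact ⟨d - R, sub_pos.2 hd.2, fun d' hd' => by linarith [hmin d' hd', id_eq d, id_eq d']⟩
  refine ⟨min ε 1, lt_min hε one_pos, fun z hz hR => ?_⟩
  rcases le_or_gt (dist p z) (R + 1) with h1 | h1
  · linarith [h _ ⟨⟨z, ⟨hz, by rwa [Metric.mem_closedBall, dist_comm]⟩, rfl⟩, hR⟩, min_le_left ε 1]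
  · linarith [min_le_right ε 1]

theorem isClosed_cell (S : Set ℍ) (x : ℍ) : IsClosed (cell S x) := by
  have : cell S x = ⋂ y ∈ S, {p | dist p x ≤ dist p y} := by ext; simp [cell]
  rw [this]
  exact isClosed_biInter fun y _ => isClosed_le (by fun_prop) (by fun_prop)

/-! ### Non-centered edges and the radius as a height -/

section Edges

variable {S : Set ℍ} {x y : ℍ} {e : Set ℍ}

theorem radius_eq (hx : x ∈ S) {p : ℍ} (hp : p ∈ cell S x) : radius S p = dist p x :=
  ((mem_cell_iff_dist_eq_radius hx).1 hp).symm

theorem mem_vertices_of_ne (hx : x ∈ S) (hy : y ∈ S) {z v : ℍ} (hz : z ∈ S) (hxy : x ≠ y)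
    (hxz : z ≠ x) (hyz : z ≠ y) (hvx : v ∈ cell S x) (hvy : v ∈ cell S y) (hvz : v ∈ cell S z) :
    v ∈ vertices S :=
  ⟨x, hx, y, hy, z, hz, hxy, hxz.symm, hyz.symm, ⟨hvx, hvy⟩, hvz⟩

theorem exists_ne_of_mem_vertices {v : ℍ} (hv : v ∈ vertices S) (x y : ℍ) :
    ∃ z ∈ S, z ≠ x ∧ z ≠ y ∧ v ∈ cell S z := by
  obtain ⟨a, ha, b, hb, c, hc, hab, hac, hbc, ⟨hva, hvb⟩, hvc⟩ := hv
  by_cases h1 : a ≠ x ∧ a ≠ y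
  · exact ⟨a, ha, h1.1, h1.2, hva⟩
  by_cases h2 : b ≠ x ∧ b ≠ y
  · exact ⟨b, hb, h2.1, h2.2, hvb⟩
  refine ⟨c, hc, ?_, ?_, hvc⟩ <;> rintro rfl <;> grind

theorem IsEdge.isClosed (h : IsEdge S x y e) : IsClosed e := by
  obtain ⟨-, -, -, rfl, -⟩ := h
  exact (isClosed_cell S x).inter (isClosed_cell S y)

theorem IsEdge.dist_eq_radius (h : IsEdge S x y e) {p : ℍ} (hp : p ∈ e) :
    dist p x = radius S p ∧ dist p y = radius S p := by
  obtain ⟨hx, hy, -, rfl, -⟩ := h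
  exact ⟨(radius_eq hx hp.1).symm, (radius_eq hy hp.2).symm⟩

theorem IsEdge.isPreconnected (h : IsEdge S x y e) : IsPreconnected e := by
  obtain ⟨hx, hy, hxy, rfl, -⟩ := h
  obtain ⟨φ, hφ⟩ := exists_isBisectorParam hxy
  have h1 : cell S x ∩ cell S y = φ '' (φ ⁻¹' (cell S x ∩ cell S y)) := by
    refine (Set.image_preimage_eq_of_subset fun p hp => ?_).symm
    exact hφ.exists_eq p (le_antisymm (hp.1 _ hy) (hp.2 _ hx))
  rw [h1]
  refine IsPreconnected.image ?_ _ hφ.isometry.continuous.continuousOn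
  refine Set.OrdConnected.isPreconnected ⟨fun r hr t ht s hs => ?_⟩
  exact hφ.mem_of_between hr ht hs.1 hs.2

theorem disjoint_vertices_edgeInterior (h : IsEdge S x y e) :
    Disjoint (vertices S) (edgeInterior e) := by
  obtain ⟨hx, hy, hxy, rfl, -⟩ := h
  rw [Set.disjoint_left]
  intro v hv hve
  obtain ⟨φ, hφ⟩ := exists_isBisectorParam hxy
  obtain ⟨s, rfl⟩ := hφ.exists_eq v (le_antisymm (hve.1.1 _ hy) (hve.1.2 _ hx))
  obtain ⟨r, t, hrs, hst, hr, ht⟩ := (hφ.mem_edgeInterior_iff hx hy).1 hve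
  obtain ⟨z, hz, hzx, hzy, hvz⟩ := exists_ne_of_mem_vertices hv x y
  have := hφ.eq_or_eq_of_mem_interior hxy hr ht hrs hst hz
    (le_antisymm (hve.1.1 _ hz) (hvz _ hx))
  tauto

/-- A noncentered edge lies on one side of the midpoint of its dual. -/
theorem exists_param_nonneg (h : IsEdge S x y e) (hn : ¬ IsCenteredEdge S x y e) :
    ∃ φ, IsBisectorParam x y φ ∧ ∀ t, φ t ∈ e → 0 ≤ t := by
  have h' := h
  obtain ⟨hx, hy, hxy, rfl, -⟩ := h
  obtain ⟨φ, hφ⟩ := exists_isBisectorParam hxy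
  by_cases h1 : ∀ t, φ t ∈ cell S x ∩ cell S y → 0 ≤ t
  · exact ⟨φ, hφ, h1⟩
  push Not at h1
  obtain ⟨r, hr, hr0⟩ := h1
  -- The edge has a point with parameter `r < 0`. Were there also one with positive parameter, `0`
  -- would be interior and the edge centered; so reversing the parameter works.
  refine ⟨_, hφ.neg, fun t ht => ?_⟩
  by_contra! ht0
  refine hn ⟨h', φ 0, (hφ.mem_edgeInterior_iff hx hy).2 ⟨r, -t, hr0, by linarith, hr, ht⟩,
    hφ.mem_geodesicArc_iff.2 rfl⟩

theorem IsBisectorParam.radius_lt_iff (hx : x ∈ S) {φ : ℝ → ℍ} (hφ : IsBisectorParam x y φ)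
    {s t : ℝ} (hs : φ s ∈ cell S x) (ht : φ t ∈ cell S x) (hs0 : 0 ≤ s) (ht0 : 0 ≤ t) :
    radius S (φ s) < radius S (φ t) ↔ s < t := by
  rw [radius_eq hx hs, radius_eq hx ht, ← cosh_dist_lt_cosh_dist, hφ.cosh_dist, hφ.cosh_dist,
    mul_lt_mul_iff_right₀ (Real.cosh_pos _), Real.cosh_lt_cosh, abs_of_nonneg hs0,
    abs_of_nonneg ht0]

/-- The radius is injective on a noncentered edge. -/
theorem eq_of_radius_eq (he : e ∈ nonCenteredEdges S) {p q : ℍ} (hp : p ∈ e) (hq : q ∈ e)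
    (h : radius S p = radius S q) : p = q := by
  obtain ⟨x, y, hxy, hn⟩ := he
  obtain ⟨φ, hφ, hpos⟩ := exists_param_nonneg hxy hn
  obtain ⟨hx, hy, -, rfl, -⟩ := hxy
  obtain ⟨s, rfl⟩ := hφ.exists_eq p (le_antisymm (hp.1 _ hy) (hp.2 _ hx))
  obtain ⟨t, rfl⟩ := hφ.exists_eq q (le_antisymm (hq.1 _ hy) (hq.2 _ hx))
  have h1 := hφ.radius_lt_iff hx hp.1 hq.1 (hpos _ hp) (hpos _ hq)
  have h2 := hφ.radius_lt_iff hx hq.1 hp.1 (hpos _ hq) (hpos _ hp)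
  rw [h, lt_self_iff_false, false_iff, not_lt] at h1
  rw [h, lt_self_iff_false, false_iff, not_lt] at h2
  rw [le_antisymm h1 h2]

/-- A point of a noncentered edge whose radius lies strictly between those of two other points is
not a vertex. -/
theorem not_mem_vertices_of_radius_between (he : e ∈ nonCenteredEdges S) {p q v : ℍ}
    (hp : p ∈ e) (hq : q ∈ e) (hv : v ∈ e) (h1 : radius S p < radius S v)
    (h2 : radius S v < radius S q) : v ∉ vertices S := by
  obtain ⟨x, y, hxy, hn⟩ := he
  obtain ⟨φ, hφ, hpos⟩ := exists_param_nonneg hxy hn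
  have hd := disjoint_vertices_edgeInterior hxy
  obtain ⟨hx, hy, -, rfl, -⟩ := hxy
  obtain ⟨r, rfl⟩ := hφ.exists_eq p (le_antisymm (hp.1 _ hy) (hp.2 _ hx))
  obtain ⟨t, rfl⟩ := hφ.exists_eq q (le_antisymm (hq.1 _ hy) (hq.2 _ hx))
  obtain ⟨s, rfl⟩ := hφ.exists_eq v (le_antisymm (hv.1 _ hy) (hv.2 _ hx))
  rw [hφ.radius_lt_iff hx hp.1 hv.1 (hpos _ hp) (hpos _ hv)] at h1
  rw [hφ.radius_lt_iff hx hv.1 hq.1 (hpos _ hv) (hpos _ hq)] at h2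
  exact fun h => Set.disjoint_left.1 hd h
    ((hφ.mem_edgeInterior_iff hx hy).2 ⟨r, t, h1, h2, hp, hq⟩)

/-- A noncentered edge contains a point that is not one of its end points. -/
theorem exists_radius_between (he : e ∈ nonCenteredEdges S) :
    ∃ p ∈ e, ∃ m ∈ e, ∃ q ∈ e, radius S p < radius S m ∧ radius S m < radius S q := by
  obtain ⟨x, y, hxy, hn⟩ := he
  obtain ⟨φ, hφ, hpos⟩ := exists_param_nonneg hxy hn
  obtain ⟨hx, hy, -, rfl, hnt⟩ := hxy
  obtain ⟨p, hp, q, hq, hpq⟩ := hnt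
  obtain ⟨r, rfl⟩ := hφ.exists_eq p (le_antisymm (hp.1 _ hy) (hp.2 _ hx))
  obtain ⟨t, rfl⟩ := hφ.exists_eq q (le_antisymm (hq.1 _ hy) (hq.2 _ hx))
  wlog hrt : r < t generalizing r t
  · exact this t hq r hp hpq.symm
      (lt_of_le_of_ne (not_lt.1 hrt) fun h => hpq (by rw [h]))
  have hm := hφ.mem_of_between hp hq (show r ≤ (r + t) / 2 by linarith) (by linarith)
  refine ⟨_, hp, _, hm, _, hq, ?_, ?_⟩
  · rw [hφ.radius_lt_iff hx hp.1 hm.1 (hpos _ hp) (hpos _ hm)]; linarith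
  · rw [hφ.radius_lt_iff hx hm.1 hq.1 (hpos _ hm) (hpos _ hq)]; linarith

/-- By the law of cosines this says that the angle at `v` in the triangle `p v x` is at least `π /
2`: the foot of the perpendicular from `x` to the bisector is the midpoint, and `p` lies beyond `v`
as seen from there. -/
theorem cosh_mul_cosh_le (h : IsEdge S x y e) (hn : ¬ IsCenteredEdge S x y e) {v p : ℍ}
    (hv : v ∈ e) (hp : p ∈ e) (hlt : radius S v < radius S p) :
    Real.cosh (dist v p) * Real.cosh (dist v x) ≤ Real.cosh (dist p x) := by
  obtain ⟨φ, hφ, hpos⟩ := exists_param_nonneg h hn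
  obtain ⟨hx, hy, -, rfl, -⟩ := h
  obtain ⟨t, rfl⟩ := hφ.exists_eq p (le_antisymm (hp.1 _ hy) (hp.2 _ hx))
  obtain ⟨s, rfl⟩ := hφ.exists_eq v (le_antisymm (hv.1 _ hy) (hv.2 _ hx))
  rw [hφ.radius_lt_iff hx hv.1 hp.1 (hpos _ hv) (hpos _ hp)] at hlt
  rw [hφ.isometry.dist_eq, hφ.cosh_dist, hφ.cosh_dist, Real.dist_eq, ← neg_sub,
    abs_neg, Real.cosh_abs]
  have e1 : Real.cosh t = Real.cosh (t - s) * Real.cosh s + Real.sinh (t - s) * Real.sinh s := by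
    rw [← Real.cosh_add]; ring_nf
  have e2 : 0 ≤ Real.sinh (t - s) * Real.sinh s :=
    mul_nonneg (Real.sinh_nonneg_iff.2 (by linarith)) (Real.sinh_nonneg_iff.2 (hpos _ hv))
  rw [mul_left_comm]
  exact mul_le_mul_of_nonneg_left (by linarith) (Real.cosh_pos _).le

/-- At most one noncentered edge emanates from a given point in the direction of increasing
radius. -/
theorem nonCenteredEdges_eq_of_radius_lt {e' : Set ℍ} (he : e ∈ nonCenteredEdges S)
    (he' : e' ∈ nonCenteredEdges S) {v p p' : ℍ} (hv : v ∈ e) (hv' : v ∈ e') (hp : p ∈ e)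
    (hp' : p' ∈ e') (h : radius S v < radius S p) (h' : radius S v < radius S p') : e = e' := by
  obtain ⟨x, y, hxy, hn⟩ := he
  obtain ⟨x', y', hxy', hn'⟩ := he'
  have ob := cosh_mul_cosh_le hxy hn hv hp h
  have ob' := cosh_mul_cosh_le hxy' hn' hv' hp' h'
  have d1 := hxy.dist_eq_radius hv
  have d2 := hxy'.dist_eq_radius hv'
  have d3 := hxy.dist_eq_radius hp
  have d4 := hxy'.dist_eq_radius hp'
  obtain ⟨hx, hy, hne, rfl, -⟩ := hxy
  obtain ⟨hx', hy', hne', rfl, -⟩ := hxy'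
  have := mem_pair_of_obtuse (v := v) (p := p) (p' := p') (by rintro rfl; exact h.ne rfl)
    (by rintro rfl; exact h'.ne rfl) hne hne' (d1.1.trans d1.2.symm) (d1.1.trans d2.1.symm)
    (d1.1.trans d2.2.symm) (d3.1.trans d3.2.symm) (hp.1 _ hx') (hp.1 _ hy')
    (d4.1.trans d4.2.symm) (hp'.1 _ hx) (hp'.1 _ hy) ob ob'
  obtain ⟨rfl | rfl, rfl | rfl⟩ := this
  · exact absurd rfl hne'
  · rfl
  · exact Set.inter_comm _ _
  · exact absurd rfl hne'

theorem inter_subset_vertices {e' : Set ℍ} (he : e ∈ nonCenteredEdges S)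
    (he' : e' ∈ nonCenteredEdges S) (hne : e ≠ e') : e ∩ e' ⊆ vertices S := by
  obtain ⟨x, y, ⟨hx, hy, hxy, rfl, -⟩, -⟩ := he
  obtain ⟨x', y', ⟨hx', hy', hxy', rfl, -⟩, -⟩ := he'
  rintro v ⟨⟨h1, h2⟩, h3, h4⟩
  by_cases hx1 : x' ≠ x ∧ x' ≠ y
  · exact mem_vertices_of_ne hx hy hx' hxy hx1.1 hx1.2 h1 h2 h3
  by_cases hy1 : y' ≠ x ∧ y' ≠ y
  · exact mem_vertices_of_ne hx hy hy' hxy hy1.1 hy1.2 h1 h2 h4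
  exfalso
  apply hne
  have h5 : x' = x ∨ x' = y := by tauto
  have h6 : y' = x ∨ y' = y := by tauto
  obtain rfl | rfl := h5 <;> obtain rfl | rfl := h6
  · exact absurd rfl hxy'
  · rfl
  · exact Set.inter_comm _ _
  · exact absurd rfl hxy'

/-- Only finitely many noncentered edges meet a given ball. -/
theorem BallFinite.finite_edges (hS : BallFinite S) (p : ℍ) (r : ℝ) :
    {e | e ∈ nonCenteredEdges S ∧ (e ∩ Metric.closedBall p r).Nonempty}.Finite := by
  rcases S.eq_empty_or_nonempty with rfl | ⟨z, hz⟩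
  · refine Set.Finite.subset Set.finite_empty ?_
    rintro e ⟨⟨x, y, ⟨hx, -⟩, -⟩, -⟩
    exact hx
  -- An edge is determined by its two sites. If it meets the ball at `q`, each site is within `r +
  -- d(q, z) ≤ d(p, z) + 2 * r` of `p`.
  have hF := hS p (dist p z + 2 * r)
  refine ((hF.prod hF).image fun q => cell S q.1 ∩ cell S q.2).subset ?_
  rintro e ⟨⟨x, y, ⟨hx, hy, -, rfl, -⟩, -⟩, q, ⟨hq1, hq2⟩, hq⟩
  rw [Metric.mem_closedBall] at hq
  have h1 := hq1 z hz
  have h2 := hq2 z hz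
  have h3 := dist_triangle q p z
  have h4 := dist_triangle p q x
  have h5 := dist_triangle p q y
  rw [dist_comm p q] at h4 h5
  refine ⟨(x, y), ⟨⟨hx, ?_⟩, ⟨hy, ?_⟩⟩, rfl⟩ <;> rw [Metric.mem_closedBall, dist_comm] <;>
    linarith

/-- The noncentered edges form a locally finite family. -/
theorem BallFinite.locallyFinite_edges (hS : BallFinite S) (E : Set (Set ℍ))
    (hE : E ⊆ nonCenteredEdges S) : LocallyFinite fun e : E => (e : Set ℍ) := fun p => by
  refine ⟨Metric.closedBall p 1, Metric.closedBall_mem_nhds p one_pos, ?_⟩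
  refine Set.Finite.of_finite_image (f := Subtype.val) ((hS.finite_edges p 1).subset ?_)
    Subtype.val_injective.injOn
  rintro _ ⟨e, he, rfl⟩
  exact ⟨hE e.2, he⟩

end Edges

/-! ### Acyclicity and connectedness of incidence graphs -/

/-- A graph is acyclic if it carries a height function such that every vertex has at most one
neighbor that is not lower. -/
theorem isAcyclic_of_height {V : Type*} (G : SimpleGraph V) (f : V → ℝ)
    (h : ∀ a b c, G.Adj a b → G.Adj a c → f a ≤ f b → f a ≤ f c → b = c) : G.IsAcyclic := by
  classical
  intro v c hc
  obtain ⟨u, hu, hmin⟩ := Finset.exists_min_image c.support.toFinset f ⟨v, by simp⟩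
  -- Start the cycle at a lowest vertex `u`: both of its neighbors on the cycle are no lower, hence
  -- equal, which a cycle forbids.
  rw [List.mem_toFinset] at hu
  have hc' := hc.rotate hu
  have hm : ∀ n, f u ≤ f ((c.rotate u hu).getVert n) := fun n => hmin _ <| by
    rw [List.mem_toFinset, ← c.mem_support_rotate_iff u hu]
    exact SimpleGraph.Walk.getVert_mem_support _ n
  exact hc'.snd_ne_penultimate (h u _ _ (SimpleGraph.Walk.adj_snd hc'.not_nil)
    (SimpleGraph.Walk.adj_penultimate hc'.not_nil).symm (hm _) (hm _))

section Incidence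

variable {V : Set ℍ} {E : Set (Set ℍ)}

theorem incidenceGraph_adj_inl_inr {v : V} {e : E} :
    (incidenceGraph V E).Adj (.inl v) (.inr e) ↔ (v : ℍ) ∈ (e : Set ℍ) := by
  rw [incidenceGraph, SimpleGraph.fromRel_adj]
  constructor
  · rintro ⟨-, ⟨v', e', h1, h2, h3⟩ | ⟨v', e', h1, h2, h3⟩⟩
    · cases h1; cases h2; exact h3
    · cases h1
  · exact fun h => ⟨by simp, .inl ⟨v, e, rfl, rfl, h⟩⟩

theorem not_incidenceGraph_adj_inl_inl {v w : V} :
    ¬ (incidenceGraph V E).Adj (.inl v) (.inl w) := by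
  rw [incidenceGraph, SimpleGraph.fromRel_adj]
  rintro ⟨-, ⟨v', e', h1, h2, h3⟩ | ⟨v', e', h1, h2, h3⟩⟩
  · cases h2
  · cases h2

theorem not_incidenceGraph_adj_inr_inr {e f : E} :
    ¬ (incidenceGraph V E).Adj (.inr e) (.inr f) := by
  rw [incidenceGraph, SimpleGraph.fromRel_adj]
  rintro ⟨-, ⟨v', e', h1, h2, h3⟩ | ⟨v', e', h1, h2, h3⟩⟩
  · cases h1
  · cases h1

/-- The incidence graph is connected if the union of the edges is, the edges being closed and
locally finite and meeting only in vertices. -/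
theorem incidenceGraph_connected (hV : V ⊆ ⋃₀ E) (hE : E.Nonempty)
    (hne : ∀ e ∈ E, e.Nonempty) (hcl : ∀ e ∈ E, IsClosed e)
    (hlf : LocallyFinite fun e : E => (e : Set ℍ))
    (hi : ∀ e ∈ E, ∀ f ∈ E, e ≠ f → e ∩ f ⊆ V) (hc : IsPreconnected (⋃₀ E)) :
    (incidenceGraph V E).Connected := by
  obtain ⟨e₀, he₀⟩ := hE
  set G := incidenceGraph V E
  have hall : ∀ e : E, G.Reachable (.inr ⟨e₀, he₀⟩) (.inr e) := by
    by_contra! hnot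
    obtain ⟨e₁, he₁⟩ := hnot
    let R : Set E := {e | G.Reachable (.inr ⟨e₀, he₀⟩) (.inr e)}
    -- By local finiteness, the unions of the reachable and of the unreachable edges are both
    -- closed. If both were nonempty they would meet, and a common point is a vertex joining a
    -- reachable edge to an unreachable one.
    have hR : ∀ A : Set E, IsClosed (⋃ e : A, ((e : E) : Set ℍ)) := fun A =>
      (hlf.comp_injective (g := fun e : A => (e : E)) Subtype.val_injective).isClosed_iUnion
        fun e => hcl _ e.1.2
    have hcov : ⋃₀ E ⊆ (⋃ e : R, ((e : E) : Set ℍ)) ∪ ⋃ e : (Rᶜ : Set E), ((e : E) : Set ℍ) := by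
      rintro p ⟨e, he, hp⟩
      by_cases h : (⟨e, he⟩ : E) ∈ R
      · exact .inl (Set.mem_iUnion.2 ⟨⟨_, h⟩, hp⟩)
      · exact .inr (Set.mem_iUnion.2 ⟨⟨_, h⟩, hp⟩)
    obtain ⟨p₀, hp₀⟩ := hne e₀ he₀
    obtain ⟨p₁, hp₁⟩ := hne e₁ e₁.2
    obtain ⟨p, -, hp1, hp2⟩ := isPreconnected_closed_iff.1 hc _ _ (hR R) (hR Rᶜ) hcov
      ⟨p₀, ⟨e₀, he₀, hp₀⟩, Set.mem_iUnion.2 ⟨⟨⟨e₀, he₀⟩, SimpleGraph.Reachable.refl _⟩, hp₀⟩⟩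
      ⟨p₁, ⟨e₁, e₁.2, hp₁⟩, Set.mem_iUnion.2 ⟨⟨e₁, he₁⟩, hp₁⟩⟩
    obtain ⟨⟨a, ha⟩, hpa⟩ := Set.mem_iUnion.1 hp1
    obtain ⟨⟨b, hb⟩, hpb⟩ := Set.mem_iUnion.1 hp2
    have hab : (a : Set ℍ) ≠ b := fun h => hb (Subtype.ext h ▸ ha)
    have hpV : p ∈ V := hi a a.2 b b.2 hab ⟨hpa, hpb⟩
    have h1 : G.Adj (.inl ⟨p, hpV⟩) (.inr a) := incidenceGraph_adj_inl_inr.2 hpa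
    have h2 : G.Adj (.inl ⟨p, hpV⟩) (.inr b) := incidenceGraph_adj_inl_inr.2 hpb
    exact hb (ha.trans (h1.symm.reachable.trans h2.reachable))
  have hroot : ∀ a, G.Reachable (.inr ⟨e₀, he₀⟩) a := by
    rintro (v | e)
    · obtain ⟨e, he, hve⟩ := hV v.2
      have h1 : G.Adj (.inl v) (.inr ⟨e, he⟩) := incidenceGraph_adj_inl_inr.2 hve
      exact (hall _).trans h1.symm.reachable
    · exact hall e
  exact { preconnected := fun a b => (hroot a).symm.trans (hroot b)
          nonempty := ⟨.inr ⟨e₀, he₀⟩⟩ }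

end Incidence

/-! ### Components are embedded trees -/

section Components

variable {S T : Set ℍ}

theorem IsNonCenteredComponent.isPreconnected (hT : IsNonCenteredComponent S T) :
    IsPreconnected T := by
  obtain ⟨p, -, rfl⟩ := hT
  exact isPreconnected_connectedComponentIn

theorem IsNonCenteredComponent.subset_of_mem (hT : IsNonCenteredComponent S T) {e : Set ℍ}
    (he : e ∈ nonCenteredEdges S) {q : ℍ} (hq : q ∈ e) (hqT : q ∈ T) : e ⊆ T := by
  obtain ⟨p, -, rfl⟩ := hT
  rw [connectedComponentIn_eq hqT]
  obtain ⟨x, y, hxy, hn⟩ := he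
  exact hxy.isPreconnected.subset_connectedComponentIn hq
    (Set.subset_sUnion_of_mem ⟨x, y, hxy, hn⟩)

theorem IsNonCenteredComponent.exists_edge (hT : IsNonCenteredComponent S T) {q : ℍ}
    (hq : q ∈ T) : ∃ e ∈ edgesOf S T, q ∈ e := by
  have hq' : q ∈ nonCenteredUnion S := by
    obtain ⟨p, -, rfl⟩ := hT
    exact connectedComponentIn_subset _ _ hq
  obtain ⟨e, he, hqe⟩ := hq'
  exact ⟨e, ⟨he, hT.subset_of_mem he hqe hq⟩, hqe⟩

theorem IsNonCenteredComponent.nonempty (hT : IsNonCenteredComponent S T) : T.Nonempty := by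
  obtain ⟨p, hp, rfl⟩ := hT
  exact ⟨p, mem_connectedComponentIn hp⟩

theorem IsNonCenteredComponent.sUnion_edgesOf (hT : IsNonCenteredComponent S T) :
    ⋃₀ edgesOf S T = T := by
  refine Set.Subset.antisymm (Set.sUnion_subset fun e he => he.2) fun q hq => ?_
  obtain ⟨e, he, hqe⟩ := hT.exists_edge hq
  exact ⟨e, he, hqe⟩

theorem incidenceGraph_isAcyclic (S T : Set ℍ) :
    (incidenceGraph (verticesOf S T) (edgesOf S T)).IsAcyclic := by
  choose p hp m hm q hq hpm hmq using
    fun e : edgesOf S T => exists_radius_between e.2.1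
  -- An edge gets the radius of a point `m e` strictly between two others. From a vertex the only
  -- neighbor that is not lower is the edge leaving upward; from an edge it is the upper end, since
  -- a second such vertex would be interior to the edge.
  refine isAcyclic_of_height _ (Sum.elim (fun v => radius S v) fun e => radius S (m e)) ?_
  rintro (v | e) (v₁ | e₁) (v₂ | e₂) h1 h2 h3 h4
  all_goals try exact absurd h1 not_incidenceGraph_adj_inl_inl
  all_goals try exact absurd h2 not_incidenceGraph_adj_inl_inl
  all_goals try exact absurd h1 not_incidenceGraph_adj_inr_inr
  all_goals try exact absurd h2 not_incidenceGraph_adj_inr_inr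
  · rw [incidenceGraph_adj_inl_inr] at h1 h2
    simp only [Sum.elim_inl, Sum.elim_inr] at h3 h4
    exact congrArg _ (Subtype.ext (nonCenteredEdges_eq_of_radius_lt e₁.2.1 e₂.2.1 h1 h2 (hq e₁)
      (hq e₂) (h3.trans_lt (hmq _)) (h4.trans_lt (hmq _))))
  · rw [SimpleGraph.adj_comm, incidenceGraph_adj_inl_inr] at h1 h2
    simp only [Sum.elim_inl, Sum.elim_inr] at h3 h4
    rcases lt_trichotomy (radius S v₁) (radius S v₂) with h | h | h
    · exact absurd v₁.2.1 (not_mem_vertices_of_radius_between e.2.1 (hp e) h2 h1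
        ((hpm e).trans_le h3) h)
    · exact congrArg _ (Subtype.ext (eq_of_radius_eq e.2.1 h1 h2 h))
    · exact absurd v₂.2.1 (not_mem_vertices_of_radius_between e.2.1 (hp e) h1 h2
        ((hpm e).trans_le h4) h)

/-- The components of the union of the noncentered edges are properly embedded trees. -/
theorem BallFinite.isEmbeddedTree (hS : BallFinite S) (hT : IsNonCenteredComponent S T) :
    IsEmbeddedTree T (verticesOf S T) (edgesOf S T) where
  subset := Set.inter_subset_right
  union_eq := hT.sUnion_edgesOf
  locallyFinite := hS.locallyFinite_edges _ fun _ he => he.1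
  inter_subset e he f hf hef :=
    Set.subset_inter (inter_subset_vertices he.1 hf.1 hef) (Set.inter_subset_left.trans he.2)
  disjoint_interior e he := by
    obtain ⟨x, y, hxy, -⟩ := he.1
    exact (disjoint_vertices_edgeInterior hxy).mono_left Set.inter_subset_left
  isTree := by
    refine ⟨incidenceGraph_connected ?_ ?_ ?_ ?_ (hS.locallyFinite_edges _ fun _ he => he.1) ?_ ?_,
      incidenceGraph_isAcyclic S T⟩
    · rw [hT.sUnion_edgesOf]
      exact Set.inter_subset_right
    · obtain ⟨q, hq⟩ := hT.nonempty
      obtain ⟨e, he, -⟩ := hT.exists_edge hq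
      exact ⟨e, he⟩
    · rintro e ⟨⟨x, y, ⟨-, -, -, -, hne⟩, -⟩, -⟩
      exact hne.nonempty
    · rintro e ⟨⟨x, y, h, -⟩, -⟩
      exact h.isClosed
    · exact fun e he f hf hef =>
        Set.subset_inter (inter_subset_vertices he.1 hf.1 hef) (Set.inter_subset_left.trans he.2)
    · rw [hT.sUnion_edgesOf]
      exact hT.isPreconnected

end Components

/-! ### Symmetries of the set of sites -/

section Isometries

variable {S : Set ℍ} {g : ℍ ≃ᵢ ℍ}

theorem mem_symm_iff (hg : ∀ z, g z ∈ S ↔ z ∈ S) (z : ℍ) : g.symm z ∈ S ↔ z ∈ S := by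
  rw [← hg, g.apply_symm_apply]

theorem image_mem_cell_iff (hg : ∀ z, g z ∈ S ↔ z ∈ S) {x p : ℍ} :
    g p ∈ cell S (g x) ↔ p ∈ cell S x := by
  constructor
  · intro h y hy
    simpa only [g.dist_eq] using h (g y) ((hg y).2 hy)
  · intro h y hy
    have := h (g.symm y) ((mem_symm_iff hg y).2 hy)
    rwa [← g.dist_eq, ← g.dist_eq p, g.apply_symm_apply] at this

theorem image_cell (hg : ∀ z, g z ∈ S ↔ z ∈ S) (x : ℍ) : g '' cell S x = cell S (g x) := by
  ext p
  obtain ⟨p, rfl⟩ := g.surjective p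
  rw [g.injective.mem_set_image, image_mem_cell_iff hg]

theorem image_mem_vertices (hg : ∀ z, g z ∈ S ↔ z ∈ S) {v : ℍ} (hv : v ∈ vertices S) :
    g v ∈ vertices S := by
  obtain ⟨x, hx, y, hy, z, hz, hxy, hxz, hyz, ⟨h1, h2⟩, h3⟩ := hv
  exact ⟨g x, (hg x).2 hx, g y, (hg y).2 hy, g z, (hg z).2 hz, g.injective.ne hxy,
    g.injective.ne hxz, g.injective.ne hyz, ⟨(image_mem_cell_iff hg).2 h1,
    (image_mem_cell_iff hg).2 h2⟩, (image_mem_cell_iff hg).2 h3⟩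

theorem radius_image (hg : ∀ z, g z ∈ S ↔ z ∈ S) (v : ℍ) : radius S (g v) = radius S v := by
  have : g '' S = S := by
    ext z
    obtain ⟨z, rfl⟩ := g.surjective z
    rw [g.injective.mem_set_image, hg]
  conv_lhs => rw [radius, ← this, Metric.infDist_image g.isometry]
  rfl

theorem image_mem_geodesicArc_iff {a b p : ℍ} :
    g p ∈ geodesicArc (g a) (g b) ↔ p ∈ geodesicArc a b := by
  simp only [geodesicArc, Set.mem_ofPred_eq, g.dist_eq]

theorem mem_edgeInterior_of_image {e : Set ℍ} {p : ℍ} (h : g p ∈ edgeInterior (g '' e)) :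
    p ∈ edgeInterior e := by
  obtain ⟨hp, _, ⟨a, ha, rfl⟩, _, ⟨b, hb, rfl⟩, hap, hbp, hab⟩ := h
  exact ⟨(g.injective.mem_set_image).1 hp, a, ha, b, hb, fun h => hap (h ▸ rfl),
    fun h => hbp (h ▸ rfl), image_mem_geodesicArc_iff.1 hab⟩

theorem image_mem_nonCenteredEdges (hg : ∀ z, g z ∈ S ↔ z ∈ S) {e : Set ℍ}
    (he : e ∈ nonCenteredEdges S) : g '' e ∈ nonCenteredEdges S := by
  obtain ⟨x, y, h, hn⟩ := he
  have h' := h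
  obtain ⟨hx, hy, hxy, rfl, hnt⟩ := h
  refine ⟨g x, g y, ⟨(hg x).2 hx, (hg y).2 hy, g.injective.ne hxy, ?_, hnt.image g.injective⟩, ?_⟩
  · rw [Set.image_inter g.injective, image_cell hg, image_cell hg]
  · rintro ⟨-, p, hp, hpa⟩
    obtain ⟨p, rfl⟩ := g.surjective p
    exact hn ⟨h', p, mem_edgeInterior_of_image hp, image_mem_geodesicArc_iff.1 hpa⟩

theorem image_nonCenteredUnion_subset (hg : ∀ z, g z ∈ S ↔ z ∈ S) :
    g '' nonCenteredUnion S ⊆ nonCenteredUnion S := by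
  rintro _ ⟨p, ⟨e, he, hp⟩, rfl⟩
  exact ⟨_, image_mem_nonCenteredEdges hg he, p, hp, rfl⟩

theorem image_nonCenteredUnion (hg : ∀ z, g z ∈ S ↔ z ∈ S) :
    g '' nonCenteredUnion S = nonCenteredUnion S := by
  refine (image_nonCenteredUnion_subset hg).antisymm fun p hp => ?_
  exact ⟨g.symm p, image_nonCenteredUnion_subset (mem_symm_iff hg) ⟨p, hp, rfl⟩,
    g.apply_symm_apply p⟩

/-- A symmetry of `S` that maps some point of a component into it preserves the component. -/
theorem IsNonCenteredComponent.image_eq {T : Set ℍ} (hT : IsNonCenteredComponent S T)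
    (hg : ∀ z, g z ∈ S ↔ z ∈ S) {p : ℍ} (hp : p ∈ T) (hgp : g p ∈ T) : g '' T = T := by
  obtain ⟨q, hq, rfl⟩ := hT
  have hpU := connectedComponentIn_subset _ _ hp
  rw [connectedComponentIn_eq hp]
  have := g.toHomeomorph.image_connectedComponentIn hpU
  simp only [IsometryEquiv.coe_toHomeomorph] at this
  rw [this, image_nonCenteredUnion hg, ← connectedComponentIn_eq hp, connectedComponentIn_eq hgp]

end Isometries

/-! ### Deck transformations -/

section Deck

theorem exists_geodesic {a b : ℍ} (hab : a ≠ b) :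
    ∃ ψ : ℝ → ℍ, Isometry ψ ∧ ψ 0 = a ∧ ψ (dist a b) = b := by
  obtain ⟨ch, hM, hN, hW, hNb, hWb⟩ := LorentzChart.exists_flag hab
  choose ψ h1 h2 h3 using fun t : ℝ => ch.surj (Real.cosh t) 0 (Real.sinh t) (Real.cosh_pos t)
    (by linarith [Real.cosh_sq t])
  have hMb : ch.M b = Real.cosh (dist a b) := by rw [ch.cosh_dist, hM, hN, hW]; ring
  refine ⟨ψ, Isometry.of_dist_eq fun s t => ?_, ?_, ?_⟩
  · rw [← dist_eq_iff_cosh_eq dist_nonneg dist_nonneg, ch.cosh_dist, h1, h1, h2, h3, h3,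
      Real.dist_eq, Real.cosh_abs, Real.cosh_sub]
    ring
  · exact ch.ext_point (by rw [h1, hM, Real.cosh_zero]) (by rw [h2, hN])
      (by rw [h3, hW, Real.sinh_zero])
  · refine ch.ext_point (by rw [h1, hMb]) (by rw [h2, hNb]) ?_
    rw [h3]
    refine (pow_left_inj₀ (Real.sinh_nonneg_iff.2 dist_nonneg) hWb.le two_ne_zero).1 ?_
    have := ch.norm_eq b
    rw [hMb, hNb] at this
    linarith [Real.cosh_sq (dist a b)]

/-- Local isometries of the hyperbolic plane do not increase distances. -/
theorem dist_le_of_locally_isometric {f : ℍ → ℍ}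
    (hf : ∀ p, ∃ r > 0, ∀ a ∈ Metric.ball p r, ∀ b ∈ Metric.ball p r, dist (f a) (f b) = dist a b)
    (a b : ℍ) : dist (f a) (f b) ≤ dist a b := by
  have hfc : Continuous f := continuous_iff_continuousAt.2 fun p => by
    obtain ⟨r, hr, h⟩ := hf p
    rw [Metric.continuousAt_iff]
    refine fun ε hε => ⟨min r ε, lt_min hr hε, fun x hx => ?_⟩
    rw [h x (hx.trans_le (min_le_left _ _)) p (Metric.mem_ball_self hr)]
    exact hx.trans_le (min_le_right _ _)
  rcases eq_or_ne a b with rfl | hab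
  · simp
  obtain ⟨ψ, hψ, h0, h1⟩ := exists_geodesic hab
  -- Continuous induction along the geodesic: the inequality is a closed condition, and local
  -- isometry together with the triangle inequality extends it to the right.
  set s : Set ℝ := {t | dist (f a) (f (ψ t)) ≤ t} with hs
  have key : Set.Icc 0 (dist a b) ⊆ s := by
    have hψc := hψ.continuous
    refine IsClosed.Icc_subset_of_forall_mem_nhdsWithin
      ((isClosed_le (by fun_prop) continuous_id).inter isClosed_Icc) ?_ ?_
    · simp [hs, h0]
    · rintro t ⟨ht, -⟩
      obtain ⟨r, hr, h⟩ := hf (ψ t)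
      filter_upwards [self_mem_nhdsWithin,
        mem_nhdsWithin_of_mem_nhds (Metric.ball_mem_nhds t hr)] with u hu hur
      have hu' : t < u := hu
      have e1 : dist (f (ψ t)) (f (ψ u)) = u - t := by
        rw [h _ (Metric.mem_ball_self hr) _ (by rwa [Metric.mem_ball, hψ.dist_eq]), hψ.dist_eq,
          dist_comm, Real.dist_eq, abs_of_pos (by linarith)]
      have ht' : dist (f a) (f (ψ t)) ≤ t := ht
      show dist (f a) (f (ψ u)) ≤ u
      linarith [dist_triangle (f a) (f (ψ t)) (f (ψ u))]
  have := key ⟨dist_nonneg, le_rfl⟩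
  rw [hs, Set.mem_ofPred_eq, h1] at this
  exact this

variable {F : Type*} [MetricSpace F] {π : ℍ → F}

theorem IsLocallyIsometricCovering.exists_lift (hπ : IsLocallyIsometricCovering π) {p q : ℍ}
    (h : π p = π q) : ∃ g : ℍ → ℍ, Continuous g ∧ g p = q ∧ (∀ z, π (g z) = π z) ∧
      ∀ a b, dist (g a) (g b) ≤ dist a b := by
  obtain ⟨g, ⟨hgp, hg⟩, -⟩ := hπ.isCoveringMap.existsUnique_continuousMap_lifts
    (⟨π, hπ.isCoveringMap.continuous⟩ : C(ℍ, F)) p q h.symm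
  have hg' : ∀ z, π (g z) = π z := fun z => congrFun hg z
  refine ⟨g, g.continuous, hgp, hg', dist_le_of_locally_isometric fun z => ?_⟩
  obtain ⟨r, hr, h1⟩ := hπ.locallyIsometric z
  obtain ⟨r', hr', h2⟩ := hπ.locallyIsometric (g z)
  obtain ⟨δ, hδ, h3⟩ := Metric.continuousAt_iff.1 g.continuous.continuousAt r' hr'
  refine ⟨min r δ, lt_min hr hδ, fun a ha b hb => ?_⟩
  rw [← h2 _ (h3 (lt_of_lt_of_le ha (min_le_right _ _))) _
    (h3 (lt_of_lt_of_le hb (min_le_right _ _))), hg', hg',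
    h1 a (Metric.ball_subset_ball (min_le_left _ _) ha) b
      (Metric.ball_subset_ball (min_le_left _ _) hb)]

theorem IsLocallyIsometricCovering.eq_id_of_fixed (hπ : IsLocallyIsometricCovering π) {g : ℍ → ℍ}
    (hg : Continuous g) (hπg : ∀ z, π (g z) = π z) {p : ℍ} (hp : g p = p) : g = id :=
  hπ.isCoveringMap.eq_of_comp_eq hg continuous_id (funext hπg) p hp

/-- Deck transformations act transitively on fibers, by isometries. -/
theorem IsLocallyIsometricCovering.exists_deck (hπ : IsLocallyIsometricCovering π) {p q : ℍ}
    (h : π p = π q) : ∃ g : ℍ ≃ᵢ ℍ, g p = q ∧ ∀ z, π (g z) = π z := by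
  obtain ⟨g, hgc, hgp, hπg, hg⟩ := hπ.exists_lift h
  obtain ⟨k, hkc, hkq, hπk, hk⟩ := hπ.exists_lift h.symm
  -- Both composites lift `π` and have a fixed point, so uniqueness of lifts makes them the
  -- identity. Neither map increases distances, so both are isometries.
  have h1 : k ∘ g = id := hπ.eq_id_of_fixed (hkc.comp hgc)
    (fun z => by rw [Function.comp_apply, hπk, hπg]) (show k (g p) = p by rw [hgp, hkq])
  have h2 : g ∘ k = id := hπ.eq_id_of_fixed (hgc.comp hkc)
    (fun z => by rw [Function.comp_apply, hπg, hπk]) (show g (k q) = q by rw [hkq, hgp])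
  refine ⟨⟨⟨g, k, congrFun h1, congrFun h2⟩, Isometry.of_dist_eq fun a b => ?_⟩, hgp, hπg⟩
  refine le_antisymm (hg a b) ?_
  calc dist a b = dist (k (g a)) (k (g b)) := by
        rw [show k (g a) = a from congrFun h1 a, show k (g b) = b from congrFun h1 b]
    _ ≤ _ := hk _ _

/-- On a ball where `π` is isometric it is injective, so such a ball contains finitely many
preimages; compactness of closed balls does the rest. -/
theorem IsLocallyIsometricCovering.ballFinite_preimage (hπ : IsLocallyIsometricCovering π)
    {S₀ : Set F} (hS₀ : S₀.Finite) : BallFinite (π ⁻¹' S₀) := fun p r => by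
  refine (isCompact_closedBall p r).induction_on (p := fun s => (π ⁻¹' S₀ ∩ s).Finite) (by simp)
    (fun s t hst ht => ht.subset (Set.inter_subset_inter_right _ hst))
    (fun s t hs ht => by rw [Set.inter_union_distrib_left]; exact hs.union ht) fun q _ => ?_
  obtain ⟨r, hr, h⟩ := hπ.locallyIsometric q
  refine ⟨_, mem_nhdsWithin_of_mem_nhds (Metric.ball_mem_nhds q hr), ?_⟩
  refine Set.Finite.of_finite_image (f := π) (hS₀.subset ?_) fun a ha b hb hab => ?_
  · rintro _ ⟨a, ha, rfl⟩
    exact ha.1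
  · rw [← dist_eq_zero, ← h a ha.2 b hb.2, hab, dist_self]

/-- Deck transformations move every point into a fixed ball if the quotient is compact. -/
theorem IsLocallyIsometricCovering.exists_fundamental_ball [CompactSpace F]
    (hπ : IsLocallyIsometricCovering π) : ∃ R, ∀ p, ∃ g : ℍ ≃ᵢ ℍ, (∀ z, π (g z) = π z) ∧
      g p ∈ Metric.closedBall UpperHalfPlane.I R := by
  obtain ⟨n, hn⟩ := isCompact_univ.elim_directed_cover
    (fun n : ℕ => π '' Metric.ball UpperHalfPlane.I n)
    (fun n => hπ.isCoveringMap.isOpenMap _ Metric.isOpen_ball)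
    (fun q _ => by
      obtain ⟨p, rfl⟩ := hπ.surjective q
      obtain ⟨n, hn⟩ := exists_nat_gt (dist p UpperHalfPlane.I)
      exact Set.mem_iUnion.2 ⟨n, p, hn, rfl⟩)
    (Monotone.directed_le fun m n hmn =>
      Set.image_mono (Metric.ball_subset_ball (by exact_mod_cast hmn)))
  refine ⟨n, fun p => ?_⟩
  obtain ⟨q, hq, hqp⟩ := hn (Set.mem_univ (π p))
  obtain ⟨g, hg, hπg⟩ := hπ.exists_deck hqp.symm
  exact ⟨g, hπg, by rw [hg]; exact Metric.ball_subset_closedBall hq⟩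

end Deck

/-! ### Climbing to the root -/

section Climbing

variable {S : Set ℍ}

/-- Otherwise three points would lie on two distinct circles. A vertex is thus determined by three
of its sites, which gives local finiteness of the vertices. -/
theorem eq_of_mem_cells {x y z v w : ℍ} (hx : x ∈ S) (hy : y ∈ S) (hz : z ∈ S) (hxy : x ≠ y)
    (hxz : x ≠ z) (hyz : y ≠ z) (hv : v ∈ cell S x ∩ cell S y ∩ cell S z)
    (hw : w ∈ cell S x ∩ cell S y ∩ cell S z) : v = w := by
  by_contra hne
  have h : ∀ u ∈ cell S x ∩ cell S y ∩ cell S z, dist u x = dist u y ∧ dist u x = dist u z :=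
    fun u hu => ⟨le_antisymm (hu.1.1 _ hy) (hu.1.2 _ hx), le_antisymm (hu.1.1 _ hz) (hu.2 _ hx)⟩
  rcases eq_or_eq_of_equidistant hne hxy (h v hv).1 (h v hv).2 (h w hw).1 (h w hw).2 with h | h
  · exact hxz h.symm
  · exact hyz h.symm

/-- Only finitely many vertices lie in a given ball. -/
theorem BallFinite.finite_vertices (hS : BallFinite S) (p : ℍ) (r : ℝ) :
    (vertices S ∩ Metric.closedBall p r).Finite := by
  rcases S.eq_empty_or_nonempty with rfl | ⟨z₀, hz₀⟩
  · refine Set.Finite.subset Set.finite_empty ?_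
    rintro v ⟨⟨x, hx, -⟩, -⟩
    exact hx
  have hF := hS p (dist p z₀ + 2 * r)
  have hU := (hF.prod (hF.prod hF)).biUnion (t := fun q => {v | q.1 ≠ q.2.1 ∧ q.1 ≠ q.2.2 ∧
    q.2.1 ≠ q.2.2 ∧ v ∈ cell S q.1 ∩ cell S q.2.1 ∩ cell S q.2.2}) fun q hq =>
      Set.Subsingleton.finite fun v hv w hw =>
        eq_of_mem_cells hq.1.1 hq.2.1.1 hq.2.2.1 hv.1 hv.2.1 hv.2.2.1 hv.2.2.2 hw.2.2.2
  refine hU.subset ?_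
  rintro v ⟨⟨x, hx, y, hy, z, hz, hxy, hxz, hyz, hv⟩, hvr⟩
  rw [Metric.mem_closedBall] at hvr
  have key : ∀ x ∈ S, v ∈ cell S x → x ∈ S ∩ Metric.closedBall p (dist p z₀ + 2 * r) := by
    intro x hx hvx
    refine ⟨hx, ?_⟩
    have h1 := hvx z₀ hz₀
    have h2 := dist_triangle v p z₀
    have h3 := dist_triangle p v x
    rw [dist_comm p v] at h3
    rw [Metric.mem_closedBall, dist_comm]
    linarith
  exact Set.mem_biUnion (x := (x, y, z)) ⟨key x hx hv.1.1, key y hy hv.1.2, key z hz hv.2⟩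
    ⟨hxy, hxz, hyz, hv⟩

theorem dist_le_of_mem_edge {ρ : ℝ} (hρ : ∀ p, radius S p ≤ ρ) {e : Set ℍ}
    (he : e ∈ nonCenteredEdges S) {p q : ℍ} (hp : p ∈ e) (hq : q ∈ e) : dist p q ≤ 2 * ρ := by
  obtain ⟨x, y, h, -⟩ := he
  have h1 := (h.dist_eq_radius hp).1
  have h2 := (h.dist_eq_radius hq).1
  linarith [dist_triangle_right p q x, hρ p, hρ q]

/-- If the radius is bounded then a noncentered edge has a vertex at which the radius is
maximal. -/
theorem BallFinite.exists_upper_vertex (hS : BallFinite S) {ρ : ℝ} (hρ : ∀ p, radius S p ≤ ρ)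
    {e : Set ℍ} (he : e ∈ nonCenteredEdges S) :
    ∃ w ∈ vertices S, w ∈ e ∧ ∀ p ∈ e, p ≠ w → radius S p < radius S w := by
  have he' := he
  obtain ⟨x, y, h, hn⟩ := he
  have hec : IsCompact e := by
    refine (isCompact_closedBall x ρ).of_isClosed_subset h.isClosed fun p hp => ?_
    rw [Metric.mem_closedBall, (h.dist_eq_radius hp).1]
    exact hρ p
  obtain ⟨w, hw, hmax⟩ := hec.exists_isMaxOn h.2.2.2.2.nonempty
    (f := fun p => dist p x) (by fun_prop)
  refine ⟨w, ?_, hw, fun p hp hpw => ?_⟩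
  swap
  · refine lt_of_le_of_ne ?_ fun hr => hpw (eq_of_radius_eq he' hp hw hr)
    rw [← (h.dist_eq_radius hp).1, ← (h.dist_eq_radius hw).1]
    exact hmax hp
  obtain ⟨φ, hφ, hpos⟩ := exists_param_nonneg h hn
  obtain ⟨hx, hy, hxy, rfl, -⟩ := h
  by_contra hwv
  obtain ⟨s, rfl⟩ := hφ.exists_eq w (le_antisymm (hw.1 _ hy) (hw.2 _ hx))
  -- If the highest point were not a vertex, every other site would be farther away by at least `ε`.
  -- Moving up by `ε / 2` changes each distance by at most `ε / 2`, so the edge would continue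
  -- beyond its highest point.
  obtain ⟨ε, hε, hgap⟩ := hS.exists_gap (φ s) (dist (φ s) x)
  have hds : ∀ z, |dist (φ (s + ε / 2)) z - dist (φ s) z| ≤ ε / 2 := fun z => by
    refine (abs_dist_sub_le _ _ _).trans ?_
    rw [hφ.isometry.dist_eq, Real.dist_eq, add_sub_cancel_left, abs_of_pos (half_pos hε)]
  have hmem : φ (s + ε / 2) ∈ cell S x ∩ cell S y := by
    rw [hφ.mem_iff]
    intro z hz
    by_cases hzx : z = x
    · rw [hzx]
    by_cases hzy : z = y
    · rw [hzy, hφ.dist_eq]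
    have hlt : dist (φ s) x < dist (φ s) z := by
      by_contra! hle
      exact hwv (mem_vertices_of_ne hx hy hz hxy hzx hzy hw.1 hw.2
        fun u hu => hle.trans (hw.1 u hu))
    linarith [hgap z hz hlt, abs_le.1 (hds x), abs_le.1 (hds z)]
  have h1 : dist (φ (s + ε / 2)) x ≤ dist (φ s) x := hmax hmem
  rw [← radius_eq hx hmem.1, ← radius_eq hx hw.1] at h1
  refine h1.not_gt ((hφ.radius_lt_iff hx hw.1 hmem.1 (hpos _ hw) (hpos _ hmem)).2 ?_)
  linarith

/-- `w` is the upper end of a noncentered edge with lower end `v`. -/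
def Climb (S : Set ℍ) (v w : ℍ) : Prop :=
  w ∈ vertices S ∧ ∃ e ∈ nonCenteredEdges S, v ∈ e ∧ w ∈ e ∧ radius S v < radius S w

/-- The upward edge is unique, and on it a lower one of two vertices above `v` would be an interior
point. -/
theorem climb_rightUnique (S : Set ℍ) : Relator.RightUnique (Climb S) := by
  rintro v w w' ⟨hw, e, he, hve, hwe, hlt⟩ ⟨hw', e', he', hve', hwe', hlt'⟩
  obtain rfl := nonCenteredEdges_eq_of_radius_lt he he' hve hve' hwe hwe' hlt hlt'
  rcases lt_trichotomy (radius S w) (radius S w') with h | h | h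
  · exact absurd hw (not_mem_vertices_of_radius_between he hve hwe' hwe hlt h)
  · exact eq_of_radius_eq he hwe hwe' h
  · exact absurd hw' (not_mem_vertices_of_radius_between he hve hwe hwe' hlt' h)

theorem radius_lt_of_climb {v w : ℍ} (h : Relation.ReflTransGen (Climb S) v w) :
    v = w ∨ radius S v < radius S w := by
  induction h with
  | refl => exact .inl rfl
  | tail _ h ih =>
    obtain ⟨-, e, -, -, -, hlt⟩ := h
    rcases ih with rfl | ih
    · exact .inr hlt
    · exact .inr (ih.trans hlt)

theorem IsNonCenteredComponent.mem_of_climb {T : Set ℍ} (hT : IsNonCenteredComponent S T)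
    {v w : ℍ} (h : Relation.ReflTransGen (Climb S) v w) (hv : v ∈ verticesOf S T) :
    w ∈ verticesOf S T := by
  induction h with
  | refl => exact hv
  | tail _ h ih =>
    obtain ⟨hw, e, he, hve, hwe, -⟩ := h
    exact ⟨hw, hT.subset_of_mem he hve ih.2 hwe⟩

theorem eq_of_climb_of_root {v r r' : ℍ} (h : Relation.ReflTransGen (Climb S) v r)
    (h' : Relation.ReflTransGen (Climb S) v r') (hr : ∀ w, ¬ Climb S r w)
    (hr' : ∀ w, ¬ Climb S r' w) : r = r' := by
  rcases Relation.ReflTransGen.total_of_right_unique (climb_rightUnique S) h h' with h | h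
  · rcases h.cases_head with h | ⟨w, hw, -⟩
    · exact h
    · exact absurd hw (hr w)
  · rcases h.cases_head with h | ⟨w, hw, -⟩
    · exact h.symm
    · exact absurd hw (hr' w)

theorem climb_iff_of_root {v w r : ℍ} (h : Climb S v w) (hr : ∀ u, ¬ Climb S r u) :
    Relation.ReflTransGen (Climb S) v r ↔ Relation.ReflTransGen (Climb S) w r := by
  refine ⟨fun hv => ?_, fun hw => hw.head h⟩
  rcases hv.cases_head with rfl | ⟨w', hw', hr'⟩
  · exact absurd h (hr w)
  · rwa [climb_rightUnique S h hw']

/-- Each climb strictly reduces the number of vertex radii above the current one and covers a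
distance of at most `2 * ρ`, the bound on the diameter of an edge. -/
theorem exists_root_of_ncard_le (hJ : (radius S '' vertices S).Finite) {ρ : ℝ}
    (hρ : ∀ p, radius S p ≤ ρ) (hρ0 : 0 ≤ ρ) (n : ℕ) (v : ℍ)
    (hn : (radius S '' vertices S ∩ Set.Ioi (radius S v)).ncard ≤ n) :
    ∃ r, Relation.ReflTransGen (Climb S) v r ∧ (∀ w, ¬ Climb S r w) ∧ dist v r ≤ 2 * ρ * n := by
  induction n generalizing v with
  | zero =>
    refine ⟨v, .refl, fun w ⟨hw, e, he, hve, hwe, hlt⟩ => ?_, by simp⟩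
    have h0 := (Set.ncard_eq_zero (hJ.inter_of_left _)).1 (Nat.le_zero.1 hn)
    exact Set.eq_empty_iff_forall_notMem.1 h0 (radius S w) ⟨⟨w, hw, rfl⟩, hlt⟩
  | succ n ih =>
    by_cases hv : ∀ w, ¬ Climb S v w
    · exact ⟨v, .refl, hv, by rw [dist_self]; positivity⟩
    push Not at hv
    obtain ⟨w, hw⟩ := hv
    obtain ⟨hwv, e, he, hve, hwe, hlt⟩ := hw
    have hlt' : (radius S '' vertices S ∩ Set.Ioi (radius S w)).ncard <
        (radius S '' vertices S ∩ Set.Ioi (radius S v)).ncard := by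
      refine Set.ncard_lt_ncard ⟨?_, fun h => ?_⟩ (hJ.inter_of_left _)
      · exact Set.inter_subset_inter_right _ (Set.Ioi_subset_Ioi hlt.le)
      · exact Set.self_notMem_Ioi (h ⟨⟨w, hwv, rfl⟩, hlt⟩).2
    obtain ⟨r, h1, h2, h3⟩ := ih w (by omega)
    refine ⟨r, h1.head ⟨hwv, e, he, hve, hwe, hlt⟩, h2, ?_⟩
    push_cast
    linarith [dist_triangle v w r, dist_le_of_mem_edge hρ he hve hwe]

/-- If the radius is bounded and takes finitely many values on vertices, then each component has a
root, from which its vertices are at bounded distance. -/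
theorem BallFinite.exists_root (hS : BallFinite S) (hJ : (radius S '' vertices S).Finite) {ρ : ℝ}
    (hρ : ∀ p, radius S p ≤ ρ) {T : Set ℍ} (hT : IsNonCenteredComponent S T) :
    ∃ r ∈ verticesOf S T, ∃ D, ∀ v ∈ verticesOf S T,
      (v = r ∨ radius S v < radius S r) ∧ dist v r ≤ D := by
  have hρ0 : 0 ≤ ρ := Metric.infDist_nonneg.trans (hρ UpperHalfPlane.I)
  have hroot := fun v => exists_root_of_ncard_le hJ hρ hρ0 (radius S '' vertices S).ncard v
    (Set.ncard_le_ncard Set.inter_subset_left hJ)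
  choose up hupv hupe hup using fun e : edgesOf S T => hS.exists_upper_vertex hρ e.2.1
  obtain ⟨q, hq⟩ := hT.nonempty
  obtain ⟨e₀, he₀, -⟩ := hT.exists_edge hq
  have hu₀ : up ⟨e₀, he₀⟩ ∈ verticesOf S T := ⟨hupv _, he₀.2 (hupe ⟨e₀, he₀⟩)⟩
  obtain ⟨r, hr1, hr2, -⟩ := hroot (up ⟨e₀, he₀⟩)
  refine ⟨r, hT.mem_of_climb hr1 hu₀, 2 * ρ * (radius S '' vertices S).ncard, fun v hv => ?_⟩
  -- `P` says that the climb from a vertex, or from the upper end of an edge, arrives at `r`.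
  -- Adjacent nodes agree on `P`, so it spreads from `e₀` over the connected incidence graph.
  let P : verticesOf S T ⊕ edgesOf S T → Prop :=
    Sum.elim (fun v => Relation.ReflTransGen (Climb S) v r)
      fun e => Relation.ReflTransGen (Climb S) (up e) r
  have hve : ∀ (v : verticesOf S T) (e : edgesOf S T), (v : ℍ) ∈ (e : Set ℍ) →
      (P (.inl v) ↔ P (.inr e)) := fun v e h => by
    by_cases hvu : (v : ℍ) = up e
    · show Relation.ReflTransGen (Climb S) v r ↔ _
      rw [hvu]
      rfl
    · exact climb_iff_of_root ⟨hupv e, e, e.2.1, h, hupe e, hup e v h hvu⟩ hr2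
  have hadj : ∀ a b, (incidenceGraph (verticesOf S T) (edgesOf S T)).Adj a b → (P a ↔ P b) := by
    rintro (v | e) (w | f) h
    · exact absurd h not_incidenceGraph_adj_inl_inl
    · exact hve v f (incidenceGraph_adj_inl_inr.1 h)
    · exact (hve w e (incidenceGraph_adj_inl_inr.1 h.symm)).symm
    · exact absurd h not_incidenceGraph_adj_inr_inr
  have hwalk : ∀ a b, (incidenceGraph (verticesOf S T) (edgesOf S T)).Walk a b →
      (P a ↔ P b) := by
    intro a b w
    induction w with
    | nil => rfl
    | cons h _ ih => exact (hadj _ _ h).trans ih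
  have hvr : Relation.ReflTransGen (Climb S) v r := by
    obtain ⟨w⟩ := (hS.isEmbeddedTree hT).isTree.connected.preconnected (.inr ⟨e₀, he₀⟩)
      (.inl ⟨v, hv⟩)
    exact (hwalk _ _ w).1 hr1
  obtain ⟨r', h1, h2, h3⟩ := hroot v
  obtain rfl := eq_of_climb_of_root hvr h1 hr2 h2
  exact ⟨radius_lt_of_climb hvr, h3⟩

end Climbing

/-! ### Closed surfaces -/

section Quotient

theorem deck_mem_preimage_iff {F : Type*} {π : ℍ → F} {S₀ : Set F} {g : ℍ → ℍ}
    (hg : ∀ z, π (g z) = π z) (z : ℍ) : g z ∈ π ⁻¹' S₀ ↔ z ∈ π ⁻¹' S₀ := by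
  rw [Set.mem_preimage, Set.mem_preimage, hg]

variable {F : Type*} [MetricSpace F] {π : ℍ → F} {S₀ : Set F}

theorem IsLocallyIsometricCovering.radius_bounded [CompactSpace F]
    (hπ : IsLocallyIsometricCovering π) (hS : (π ⁻¹' S₀).Nonempty) :
    ∃ ρ, ∀ p, radius (π ⁻¹' S₀) p ≤ ρ := by
  obtain ⟨R, hR⟩ := hπ.exists_fundamental_ball
  obtain ⟨z, hz⟩ := hS
  refine ⟨R + dist UpperHalfPlane.I z, fun p => ?_⟩
  obtain ⟨g, hg, hgp⟩ := hR p
  rw [← radius_image (g := g) (deck_mem_preimage_iff hg)]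
  refine (Metric.infDist_le_dist_of_mem hz).trans ((dist_triangle _ UpperHalfPlane.I _).trans ?_)
  exact add_le_add_left hgp _

/-- Deck transformations preserve the radius and move every vertex into one ball, which contains
only finitely many vertices. -/
theorem IsLocallyIsometricCovering.finite_radius_vertices [CompactSpace F]
    (hπ : IsLocallyIsometricCovering π) (hS₀ : S₀.Finite) :
    (radius (π ⁻¹' S₀) '' vertices (π ⁻¹' S₀)).Finite := by
  obtain ⟨R, hR⟩ := hπ.exists_fundamental_ball
  refine (((hπ.ballFinite_preimage hS₀).finite_vertices UpperHalfPlane.I R).image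
    (radius (π ⁻¹' S₀))).subset ?_
  rintro _ ⟨v, hv, rfl⟩
  obtain ⟨g, hg, hgv⟩ := hR v
  exact ⟨g v, ⟨image_mem_vertices (deck_mem_preimage_iff hg) hv, hgv⟩,
    radius_image (deck_mem_preimage_iff hg) v⟩

theorem IsLocallyIsometricCovering.component_finite [CompactSpace F]
    (hπ : IsLocallyIsometricCovering π) (hS₀ : S₀.Finite) {T : Set ℍ}
    (hT : IsNonCenteredComponent (π ⁻¹' S₀) T) :
    (verticesOf (π ⁻¹' S₀) T).Finite ∧ (edgesOf (π ⁻¹' S₀) T).Finite ∧ IsCompact T ∧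
      (∃! vT : ℍ, vT ∈ verticesOf (π ⁻¹' S₀) T ∧ ∀ v ∈ verticesOf (π ⁻¹' S₀) T, v ≠ vT →
        radius (π ⁻¹' S₀) v < radius (π ⁻¹' S₀) vT) ∧
      Topology.IsEmbedding (T.domRestrict π) := by
  have hS := hπ.ballFinite_preimage hS₀
  have hJ := hπ.finite_radius_vertices hS₀
  obtain ⟨q₀, hq₀⟩ := hT.nonempty
  obtain ⟨e₀, ⟨⟨x, y, ⟨hx, -⟩, -⟩, -⟩, -⟩ := hT.exists_edge hq₀
  obtain ⟨ρ, hρ⟩ := hπ.radius_bounded ⟨x, hx⟩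
  obtain ⟨r, hr, D, hD⟩ := hS.exists_root hJ hρ hT
  -- A point of `T` is within `2 * ρ` of the upper vertex of an edge through it, and that vertex is
  -- within `D` of the root.
  have hTb : T ⊆ Metric.closedBall r (2 * ρ + D) := fun q hq => by
    obtain ⟨e, he, hqe⟩ := hT.exists_edge hq
    obtain ⟨w, hw, hwe, -⟩ := hS.exists_upper_vertex hρ he.1
    rw [Metric.mem_closedBall]
    linarith [dist_triangle q w r, dist_le_of_mem_edge hρ he.1 hqe hwe, (hD w ⟨hw, he.2 hwe⟩).2]
  have hE : (edgesOf (π ⁻¹' S₀) T).Finite := by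
    refine (hS.finite_edges r (2 * ρ + D)).subset fun e he => ⟨he.1, ?_⟩
    obtain ⟨⟨x, y, ⟨-, -, -, -, hne⟩, -⟩, heT⟩ := he
    obtain ⟨p, hp⟩ := hne.nonempty
    exact ⟨p, hp, hTb (heT hp)⟩
  have hTc : IsCompact T := by
    refine (isCompact_closedBall r (2 * ρ + D)).of_isClosed_subset ?_ hTb
    rw [← hT.sUnion_edgesOf, Set.sUnion_eq_biUnion]
    exact hE.isClosed_biUnion fun e he => he.1.choose_spec.choose_spec.1.isClosed
  refine ⟨(hS.finite_vertices r (2 * ρ + D)).subset fun v hv => ⟨hv.1, hTb hv.2⟩, hE, hTc,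
    ⟨r, ⟨hr, fun v hv hvr => (hD v hv).1.resolve_left hvr⟩, fun r' hr' => ?_⟩, ?_⟩
  · by_contra hne
    exact lt_asymm (hr'.2 r hr (Ne.symm hne)) ((hD r' hr'.1).1.resolve_left hne)
  · have : CompactSpace T := isCompact_iff_compactSpace.1 hTc
    refine (Continuous.isClosedEmbedding (hπ.isCoveringMap.continuous.comp continuous_subtype_val)
      ?_).isEmbedding
    rintro ⟨p, hp⟩ ⟨q, hq⟩ hpq
    obtain ⟨g, hgp, hg⟩ := hπ.exists_deck (show π p = π q from hpq)
    have hgS := deck_mem_preimage_iff (S₀ := S₀) hg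
    have hgr : g r ∈ verticesOf (π ⁻¹' S₀) T :=
      ⟨image_mem_vertices hgS hr.1,
        hT.image_eq hgS hp (by rwa [hgp]) ▸ Set.mem_image_of_mem g hr.2⟩
    -- `g r` is a vertex of `T` with the same radius as `r`, and the maximum at `r` is strict.
    have hfix : g r = r := (hD _ hgr).1.resolve_right (radius_image hgS r).not_lt
    have hid := hπ.eq_id_of_fixed g.continuous hg hfix
    exact Subtype.ext ((congrFun hid p).symm.trans hgp)

end Quotient
end HypVoronoi

theorem mainTheorem5 :
    (∀ S : Set UpperHalfPlane, IsClosed S → IsDiscrete S →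
      ∀ T : Set UpperHalfPlane, HypVoronoi.IsNonCenteredComponent S T →
        HypVoronoi.IsEmbeddedTree T (HypVoronoi.verticesOf S T) (HypVoronoi.edgesOf S T)) ∧
    (∀ (F : Type*) [MetricSpace F] [CompactSpace F] (π : UpperHalfPlane → F),
      HypVoronoi.IsLocallyIsometricCovering π →
      ∀ S₀ : Set F, S₀.Finite →
      ∀ S : Set UpperHalfPlane, S = π ⁻¹' S₀ →
      ∀ T : Set UpperHalfPlane, HypVoronoi.IsNonCenteredComponent S T →
        HypVoronoi.IsEmbeddedTree T (HypVoronoi.verticesOf S T) (HypVoronoi.edgesOf S T) ∧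
        (HypVoronoi.verticesOf S T).Finite ∧ (HypVoronoi.edgesOf S T).Finite ∧ IsCompact T ∧
        (∃! vT : UpperHalfPlane, vT ∈ HypVoronoi.verticesOf S T ∧
          ∀ v ∈ HypVoronoi.verticesOf S T, v ≠ vT →
            HypVoronoi.radius S v < HypVoronoi.radius S vT) ∧
        Topology.IsEmbedding (T.domRestrict π)) := by
  refine ⟨fun S hc hd T hT =>
    (HypVoronoi.ballFinite_of_isClosed_of_isDiscrete hc hd).isEmbeddedTree hT, ?_⟩
  rintro F _ _ π hπ S₀ hS₀ S rfl T hT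
  exact ⟨(hπ.ballFinite_preimage hS₀).isEmbeddedTree hT, hπ.component_finite hS₀ hT⟩
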